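/- Let $d\in\mathbb N$, $1\le p<\infty$, let $L^p(\mathbb R^d)$ be the real or complex Lebesgue space with norm $\|\cdot\|$, and let $k\in L^1_{\mathrm{loc}}([0,\infty))$ be completely monotone on $(0,\infty)$. Put $m=1+k$ and $\varphi^m(\lambda)=1/\hat m(\lambda)$ for $\lambda>0$, where $\hat{\ }$ is the Laplace transform. Let $w$ be the propagation function of $m$: for each $\tau\ge0$, $w(\cdot,\tau)$ is the unique nondecreasing, left-continuous function on $[0,\infty)$ with $w(0,\tau)=0$ and $\int_0^\infty e^{-\lambda t}w(t,\tau)\,dt=\lambda^{-1}e^{-\tau\varphi^m(\lambda)}$ for all $\lambda>0$. Let $e^{\tau\Delta}$ be the heat semigroup on $L^p(\mathbb R^d)$ and let $$S(t)v=-\int_0^\infty e^{\tau\Delta}v\;d_\tau w(t,\tau),\qquad t\ge0,\ v\in L^p(\mathbb R^d)$$ (with $w(t,\tau)$ read as $1$ for $\tau<0$ in the Stieltjes measure, so that $S(0)=I$); these are the solution operators of $\partial_tu-(1+\partial_t^{*k})\Delta u=0$, $u(0)=v$, where $\partial_t^{*k}g(t)=\frac{d}{dt}\int_0^tk(t-s)g(s)\,ds$.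 Let $f:L^p(\mathbb R^d)\to L^p(\mathbb R^d)$ satisfy $(F_f)$: $f(0)=0$ and there is $L_f>0$ with $\|f(u)-f(v)\|\le L_f\|u-v\|$ for all $u,v\in L^p(\mathbb R^d)$. Let $\mathcal C=C([0,\infty);L^p(\mathbb R^d))$, with the metric of uniform convergence on compact sets $$\rho(\varphi,h)=\sum_{n=1}^\infty\frac1{2^n}\,\frac{\sup_{t\in[0,n]}\|\varphi(t)-h(t)\|}{1+\sup_{t\in[0,n]}\|\varphi(t)-h(t)\|}.$$ **Theorem.** For every $\varphi\in\mathcal C$ there is a unique $u_\varphi\in\mathcal C$ with $$u_\varphi(t)=\varphi(t)+\int_0^tS(t-s)f(u_\varphi(s))\,ds\qquad(t\ge0).$$ For $t\ge0$ and $\varphi\in\mathcal C$ the formula $$(T_t\varphi)(\theta)=\varphi(t+\theta)+\int_0^tS(t+\theta-\tau)f(u_\varphi(\tau))\,d\tau\qquad(\theta\ge0)$$ is well defined (the integrand is integrable) and defines an element $T_t\varphi$ of $\mathcal C$. The operators $T_t:\mathcal C\to\mathcal C$ form a semigroup of Lipschitz maps of $(\mathcal C,\rho)$: $T_0=I$;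 $T_{t+s}=T_t\circ T_s$ for all $t,s\ge0$; and for every $t\ge0$ there is a constant $K\ge0$ with $\rho(T_t\varphi,T_t\psi)\le K\rho(\varphi,\psi)$ for all $\varphi,\psi\in\mathcal C$. -/

import Mathlib

open MeasureTheory Set
open scoped NNReal ENNReal

namespace RayleighStokes

noncomputable section

/-- The space `L^p(ℝ^d)` with values in `𝕜 = ℝ` or `ℂ`. -/
abbrev LpSpace (𝕜 : Type) [RCLike 𝕜] (d : ℕ) (p : ℝ≥0∞) : Type :=
  Lp 𝕜 p (volume : Measure (EuclideanSpace ℝ (Fin d)))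

/-- The space `𝒞` of all continuous functions `[0, ∞) → L^p(ℝ^d)`. -/
abbrev PathSpace (𝕜 : Type) [RCLike 𝕜] (d : ℕ) (p : ℝ≥0∞) [Fact (1 ≤ p)] : Type :=
  C(ℝ≥0, LpSpace 𝕜 d p)

/-! ### Kernels and propagation functions -/

/-- `k` is completely monotone on `(0, ∞)`: it is smooth there and `(-1)^n k^{(n)} ≥ 0` there. -/
def IsCompletelyMonotone (k : ℝ → ℝ) : Prop :=
  ContDiffOn ℝ (⊤ : ℕ∞) k (Ioi 0) ∧
    ∀ (n : ℕ) (t : ℝ), 0 < t → 0 ≤ (-1) ^ n * iteratedDerivWithin n k (Ioi 0) t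

/-- `k ∈ L^1_loc`, including integrability near the left end point `0`. -/
def IsLocallyIntegrableKernel (k : ℝ → ℝ) : Prop :=
  ∀ R : ℝ, 0 < R → IntegrableOn k (Ioc 0 R)

/-- The Laplace transform `∫_0^∞ e^{-λt} g(t) dt`. -/
def laplace (g : ℝ → ℝ) (lam : ℝ) : ℝ :=
  ∫ t in Ioi (0 : ℝ), Real.exp (-(lam * t)) * g t

/-- The function `φ^m(λ) = 1 / m̂(λ)`. -/
def laplaceExponent (m : ℝ → ℝ) (lam : ℝ) : ℝ := 1 / laplace m lam

/-- `w` is the propagation function of the kernel `m`: for every `τ ≥ 0` the function `w(·, τ)` is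
nondecreasing and left-continuous on `[0, ∞)`, vanishes at `0`, and has the Laplace transform
`λ ↦ e^{-τ φ^m(λ)} / λ`. By uniqueness of the Laplace transform there is at most one such function
on `[0, ∞) × [0, ∞)`. -/
def IsPropagationFunction (m : ℝ → ℝ) (w : ℝ → ℝ → ℝ) : Prop :=
  ∀ τ : ℝ, 0 ≤ τ →
    MonotoneOn (fun t => w t τ) (Ici 0) ∧
    w 0 τ = 0 ∧
    (∀ t : ℝ, 0 < t → ContinuousWithinAt (fun r => w r τ) (Iic t) t) ∧
    ∀ lam : ℝ, 0 < lam →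
      IntegrableOn (fun t => Real.exp (-(lam * t)) * w t τ) (Ioi 0) ∧
      laplace (fun t => w t τ) lam = Real.exp (-(τ * laplaceExponent m lam)) / lam

open Classical in
/-- The propagation function `w(t, τ)` of the kernel `m` (for completely positive `m`, so in
particular for `m = 1 + k` with `k` completely monotone, it exists by Bernstein's theorem). -/
def propagation (m : ℝ → ℝ) : ℝ → ℝ → ℝ :=
  if h : ∃ w, IsPropagationFunction m w then h.choose else fun _ _ => 0

/-- The function `τ ↦ -w(t, τ)`, continued by the value `-1` to `τ < 0`. -/
def negPropagation (m : ℝ → ℝ) (t τ : ℝ) : ℝ :=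
  if τ < 0 then -1 else -propagation m t τ

open Classical in
/-- The Lebesgue-Stieltjes measure `-d_τ w(t, τ)`, for `t ≥ 0` (the function `w(t, ·)` is
nonincreasing with values in `[0, 1]`). It is carried by `[0, ∞)`; for `t = 0`, where
`w(0, τ) = 0` for all `τ > 0`, it is the Dirac measure at `0`. -/
def propagationMeasure (m : ℝ → ℝ) (t : ℝ) : Measure ℝ :=
  if h : Monotone (negPropagation m t) then h.stieltjesFunction.measure else 0

/-! ### The heat semigroup and the solution operators -/

/-- The Gaussian heat kernel `G(τ, y) = (4πτ)^{-d/2} e^{-|y|²/(4τ)}` on `ℝ^d`. -/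
def heatKernel (d : ℕ) (τ : ℝ) (y : EuclideanSpace ℝ (Fin d)) : ℝ :=
  (4 * Real.pi * τ) ^ (-(d : ℝ) / 2) * Real.exp (-‖y‖ ^ 2 / (4 * τ))

variable {𝕜 : Type} [RCLike 𝕜] {d : ℕ} {p : ℝ≥0∞}

/-- The translate `x ↦ v(x - y)`. -/
def translate (y : EuclideanSpace ℝ (Fin d)) (v : LpSpace 𝕜 d p) : LpSpace 𝕜 d p :=
  Lp.compMeasurePreserving (fun x => x - y) (measurePreserving_sub_right volume y) v

variable [Fact (1 ≤ p)]

/-- The heat semigroup `T(τ) = e^{τΔ}` on `L^p(ℝ^d)`: `T(0) = I`, and for `τ > 0` it is the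
convolution with the heat kernel, `T(τ)v = ∫ G(τ, y) v(· - y) dy`, an `L^p`-valued integral. -/
def heatSemigroup (τ : ℝ) (v : LpSpace 𝕜 d p) : LpSpace 𝕜 d p :=
  if τ ≤ 0 then v else ∫ y : EuclideanSpace ℝ (Fin d), heatKernel d τ y • translate y v

/-- The solution operators `S(t)v = -∫_0^∞ T(τ)v d_τ w(t, τ)`, where `w` is the propagation function
of the kernel `m = 1 + k`. -/
def solutionOperator (k : ℝ → ℝ) (t : ℝ) (v : LpSpace 𝕜 d p) : LpSpace 𝕜 d p :=
  ∫ τ, heatSemigroup τ v ∂(propagationMeasure (fun r => 1 + k r) t)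

/-! ### The nonlinear equation and the metric -/

/-- Condition `(F_f)`: `f(0) = 0` and `f` is globally Lipschitz continuous on `L^p(ℝ^d)`. -/
def ConditionFf (f : LpSpace 𝕜 d p → LpSpace 𝕜 d p) : Prop :=
  f 0 = 0 ∧ ∃ L : ℝ, 0 < L ∧ ∀ u v, ‖f u - f v‖ ≤ L * ‖u - v‖

/-- The integrand `τ ↦ S(r - τ) f(u(τ))`, for `0 ≤ τ ≤ r`. -/
def duhamelIntegrand (k : ℝ → ℝ) (f : LpSpace 𝕜 d p → LpSpace 𝕜 d p) (u : PathSpace 𝕜 d p)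
    (r τ : ℝ) : LpSpace 𝕜 d p :=
  solutionOperator k (r - τ) (f (u τ.toNNReal))

/-- `u ∈ 𝒞` is a generalized mild solution for `φ`:
`u(t) = φ(t) + ∫_0^t S(t - s) f(u(s)) ds` for all `t ≥ 0`. -/
def IsGeneralizedMildSolution (k : ℝ → ℝ) (f : LpSpace 𝕜 d p → LpSpace 𝕜 d p)
    (φ u : PathSpace 𝕜 d p) : Prop :=
  ∀ t : ℝ≥0,
    IntervalIntegrable (duhamelIntegrand k f u t) volume 0 t ∧
    u t = φ t + ∫ s in (0 : ℝ)..t, duhamelIntegrand k f u t s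

/-- `sup_{t ∈ [0, n]} ‖φ(t) - h(t)‖`. -/
def supDist (n : ℕ) (φ h : PathSpace 𝕜 d p) : ℝ :=
  sSup ((fun t : ℝ≥0 => ‖φ t - h t‖) '' Icc 0 (n : ℝ≥0))

/-- The metric `ρ(φ, h) = ∑_{n ≥ 1} 2^{-n} ρ_n(φ, h)` of uniform convergence on compact sets, where
`ρ_n = s_n / (1 + s_n)` with `s_n = sup_{t ∈ [0, n]} ‖φ(t) - h(t)‖`. -/
def rho (φ h : PathSpace 𝕜 d p) : ℝ :=
  ∑' n : ℕ, (1 / 2 ^ (n + 1)) * (supDist (n + 1) φ h / (1 + supDist (n + 1) φ h))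

end

end RayleighStokes

namespace RayleighStokes

open Filter Topology Polynomial

/-! ### Completely monotone functions -/

/-! Only two properties of `S` matter: each `S(t)` is nonexpansive, and `t ↦ S(t)v` is strongly
measurable. With them `A t = S(t) ∘ f` is a measurable family of `L`-Lipschitz maps fixing `0`
(`IsLipschitzFamily`), and the rest is the theory of `u = φ + ∫ A(t-s)u(s) ds`.

Nonexpansiveness requires that `w(t, ·)` exist, take values in `[0, 1]` and be nonincreasing. For
this `e^{-τφ^m}` is shown to be the Laplace transform of a probability law on `[0, ∞]`, coded on the
unit interval by `x = e^{-t}`, so that `t = ∞` is `x = 0` and the space is compact. Complete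
monotonicity makes the integrals `a n` of `1 + k` over the cells of a grid log-convex. By Kaluza's
theorem `1 - a 0 / A(z)`, where `A(z) = ∑ a n z^n`, has nonnegative coefficients; hence `1 - c /
A(e^{-λh})` is a Laplace transform for small `c`, and so is `e^{-τ/A}` as a limit of `n`-th powers.
Letting `h → 0` gives `e^{-τφ^m}`. Moments determine the laws, hence `w`; the product rule in `τ`
makes `w` nonincreasing in `τ`, and monotonicity in `t` makes the Stieltjes measures measurable in
`t`.

For the Volterra equation, the weight `e^{-2Lt}` turns the integral operator into a contraction of
factor `1/2`, which yields existence, uniqueness and the stability estimate. A solution restarted at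
time `s` solves the equation with datum `T_s φ`, so uniqueness gives the semigroup law. Finally
`T_t` enlarges the window `[0, n]` by at most `N ≥ t`, which costs a factor `2^N` in `ρ`. -/

theorem isCompletelyMonotone_iff {k : ℝ → ℝ} :
    IsCompletelyMonotone k ↔ ContDiffOn ℝ (⊤ : ℕ∞) k (Ioi 0) ∧
      ∀ (n : ℕ) (t : ℝ), 0 < t → 0 ≤ (-1) ^ n * iteratedDeriv n k t := by
  unfold IsCompletelyMonotone
  refine and_congr_right fun _ => forall_congr' fun n => forall_congr' fun t =>
    forall_congr' fun ht => ?_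
  rw [iteratedDerivWithin_of_isOpen isOpen_Ioi (mem_Ioi.2 ht)]

theorem IsCompletelyMonotone.contDiffAt {k : ℝ → ℝ} (hk : IsCompletelyMonotone k) {t : ℝ}
    (ht : 0 < t) (n : ℕ) : ContDiffAt ℝ n k t :=
  (hk.1.contDiffAt (isOpen_Ioi.mem_nhds ht)).of_le (by exact_mod_cast le_top)

theorem IsCompletelyMonotone.nonneg {k : ℝ → ℝ} (hk : IsCompletelyMonotone k) {t : ℝ}
    (ht : 0 < t) : 0 ≤ k t := by
  simpa using (isCompletelyMonotone_iff.1 hk).2 0 t ht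

theorem IsCompletelyMonotone.antitoneOn_iteratedDeriv {k : ℝ → ℝ} (hk : IsCompletelyMonotone k)
    (n : ℕ) : AntitoneOn (fun t => (-1) ^ n * iteratedDeriv n k t) (Ioi 0) := by
  have hd : ∀ t : ℝ, 0 < t → DifferentiableAt ℝ (iteratedDeriv n k) t := by
    intro t ht
    have h1 := (hk.1.differentiableOn_iteratedDerivWithin (m := n)
      (by exact_mod_cast WithTop.coe_lt_top _) (uniqueDiffOn_Ioi 0)).differentiableAt (isOpen_Ioi.mem_nhds ht)
    refine h1.congr_of_eventuallyEq ?_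
    filter_upwards [isOpen_Ioi.mem_nhds ht] with s hs
    rw [iteratedDerivWithin_of_isOpen isOpen_Ioi hs]
  refine antitoneOn_of_deriv_nonpos (convex_Ioi 0) ?_ ?_ ?_
  · exact fun t ht => ((hd t ht).const_mul _).continuousAt.continuousWithinAt
  · rw [interior_Ioi]
    exact fun t ht => ((hd t ht).const_mul _).differentiableWithinAt
  · rw [interior_Ioi]
    intro t ht
    rw [deriv_const_mul _ (hd t ht), ← iteratedDeriv_succ]
    have := (isCompletelyMonotone_iff.1 hk).2 (n + 1) t ht
    rw [pow_succ] at this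
    linarith

theorem IsCompletelyMonotone.antitoneOn {k : ℝ → ℝ} (hk : IsCompletelyMonotone k) :
    AntitoneOn k (Ioi 0) := by
  simpa using hk.antitoneOn_iteratedDeriv 0

/-- Every signed derivative of `k` is nonincreasing. This is the inductive step for differences of
all orders. -/
theorem IsCompletelyMonotone.sub_shift {k : ℝ → ℝ} (hk : IsCompletelyMonotone k) {h : ℝ}
    (hh : 0 ≤ h) : IsCompletelyMonotone (fun t => k t - k (t + h)) := by
  refine isCompletelyMonotone_iff.2 ⟨?_, fun n t ht => ?_⟩
  · refine hk.1.sub (hk.1.comp (by fun_prop) fun t ht => ?_)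
    exact mem_Ioi.2 (by linarith [mem_Ioi.1 ht])
  · have hth : 0 < t + h := by linarith
    have h1 : ContDiffAt ℝ n (fun s => k (s + h)) t :=
      ContDiffAt.comp (g := k) t (hk.contDiffAt hth n) (by fun_prop)
    have h2 := iteratedDeriv_fun_sub (hk.contDiffAt ht n) h1
    rw [h2, iteratedDeriv_comp_add_const, mul_sub, sub_nonneg]
    exact hk.antitoneOn_iteratedDeriv n (mem_Ioi.2 ht) (mem_Ioi.2 hth) (by linarith)

/-- The linear functional on polynomials with the moments `L(X^n) = a n`. -/
noncomputable def momentFunctional (a : ℕ → ℝ) : ℝ[X] →ₗ[ℝ] ℝ :=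
  (Polynomial.basisMonomials ℝ).constr ℝ a

theorem momentFunctional_X_pow (a : ℕ → ℝ) (n : ℕ) : momentFunctional a (X ^ n) = a n := by
  rw [momentFunctional, ← monomial_one_right_eq_X_pow]
  have := (Polynomial.basisMonomials ℝ).constr_basis ℝ a n
  simpa using this

theorem momentFunctional_one_sub_X_mul (a : ℕ → ℝ) (p : ℝ[X]) :
    momentFunctional a ((1 - X) * p) = momentFunctional (fun n => a n - a (n + 1)) p := by
  induction p using Polynomial.induction_on' with
  | add p q hp hq => rw [mul_add, map_add, map_add, hp, hq]
  | monomial n c =>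
    rw [← smul_X_eq_monomial, mul_smul_comm, map_smul, map_smul, momentFunctional_X_pow, sub_mul,
      one_mul, ← pow_succ', map_sub, momentFunctional_X_pow, momentFunctional_X_pow]

/-- Multiplication by `1 - X` replaces `k` by `k - k(· + h)`, again completely monotone, so
induction on `i` applies with `k` varying. -/
theorem IsCompletelyMonotone.momentFunctional_nonneg {h t : ℝ} (hh : 0 ≤ h) (ht : 0 < t)
    (i j : ℕ) {k : ℝ → ℝ} (hk : IsCompletelyMonotone k) :
    0 ≤ momentFunctional (fun n => k (t + n * h)) ((1 - X) ^ i * X ^ j) := by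
  induction i generalizing k with
  | zero =>
    rw [pow_zero, one_mul, momentFunctional_X_pow]
    exact hk.nonneg (by positivity)
  | succ i ih =>
    rw [pow_succ', mul_assoc, momentFunctional_one_sub_X_mul]
    convert ih (hk.sub_shift hh) using 6
    push_cast
    ring

/-- The expression is `L((X - c)^2)`. The moment functional `L` is nonnegative on Bernstein
polynomials, and the Bernstein approximation of `(X - c)^2` differs from it by `X(1 - X)/n`. This is
log-convexity of `k` in a form linear in `k`, so it can be integrated. -/
theorem IsCompletelyMonotone.quadratic_nonneg {k : ℝ → ℝ} (hk : IsCompletelyMonotone k)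
    {h t : ℝ} (hh : 0 ≤ h) (ht : 0 < t) (c : ℝ) :
    0 ≤ k (t + 2 * h) - 2 * c * k (t + h) + c ^ 2 * k t := by
  set L := momentFunctional (fun n => k (t + n * h)) with hL
  have h0 : L 1 = k t := by simpa using momentFunctional_X_pow (fun n => k (t + n * h)) 0
  have h1 : L X = k (t + h) := by simpa using momentFunctional_X_pow (fun n => k (t + n * h)) 1
  have h2 : L (X ^ 2) = k (t + 2 * h) := by
    simpa using momentFunctional_X_pow (fun n => k (t + n * h)) 2
  have key : ∀ n : ℕ, 0 < n → 0 ≤ (k (t + 2 * h) - 2 * c * k (t + h) + c ^ 2 * k t)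
      + (k (t + h) - k (t + 2 * h)) * (1 / (n : ℝ)) := by
    intro n hn
    have e0 := congrArg L (bernsteinPolynomial.sum ℝ n)
    have e1 := congrArg L (bernsteinPolynomial.sum_smul ℝ n)
    have e2 := congrArg L (bernsteinPolynomial.sum_mul_smul ℝ n)
    rw [map_sum, h0] at e0
    rw [map_sum, map_nsmul, h1] at e1
    rw [map_sum, map_nsmul, h2] at e2
    have hLc : ∀ (m : ℕ) (q : ℝ[X]), L ((m : ℝ[X]) * q) = m * L q := fun m q => by
      rw [← nsmul_eq_mul, map_nsmul, nsmul_eq_mul]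
    simp only [nsmul_eq_mul, hLc] at e1 e2
    have hw : ∀ ν, 0 ≤ L (bernsteinPolynomial ℝ n ν) := by
      intro ν
      have : bernsteinPolynomial ℝ n ν = (n.choose ν) • ((1 - X) ^ (n - ν) * X ^ ν) := by
        rw [bernsteinPolynomial, nsmul_eq_mul]; ring
      rw [this, map_nsmul]
      exact nsmul_nonneg (hk.momentFunctional_nonneg hh ht _ _) _
    have hs : 0 ≤ ∑ ν ∈ Finset.range (n + 1),
        L (bernsteinPolynomial ℝ n ν) * ((ν : ℝ) - n * c) ^ 2 :=
      Finset.sum_nonneg fun ν _ => mul_nonneg (hw ν) (sq_nonneg _)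
    have hcast : ∀ m : ℕ, ((m * (m - 1) : ℕ) : ℝ) = (m : ℝ) ^ 2 - m := by
      intro m
      cases m with
      | zero => simp
      | succ m => push_cast [Nat.add_sub_cancel]; ring
    -- `n^2` times `L` of the `n`-th Bernstein approximation of `(X - c)^2`, expanded through the
    -- three Bernstein moment identities.
    have hs' : ∑ ν ∈ Finset.range (n + 1),
        L (bernsteinPolynomial ℝ n ν) * ((ν : ℝ) - n * c) ^ 2
        = ((n : ℝ) ^ 2 - n) * k (t + 2 * h) + (1 - 2 * n * c) * (n * k (t + h))
          + (n * c) ^ 2 * k t := by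
      rw [← hcast n, ← e2, ← e1, ← e0, Finset.mul_sum, Finset.mul_sum, ← Finset.sum_add_distrib,
        ← Finset.sum_add_distrib]
      refine Finset.sum_congr rfl fun ν _ => ?_
      rw [hcast ν]
      ring
    rw [hs'] at hs
    have hn' : (0 : ℝ) < n := by exact_mod_cast hn
    have : (k (t + 2 * h) - 2 * c * k (t + h) + c ^ 2 * k t)
      + (k (t + h) - k (t + 2 * h)) * (1 / (n : ℝ)) = (((n : ℝ) ^ 2 - n) * k (t + 2 * h)
        + (1 - 2 * n * c) * (n * k (t + h)) + (n * c) ^ 2 * k t) / n ^ 2 := by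
      field_simp
      ring
    rw [this]
    positivity
  have hlim : Tendsto (fun n : ℕ => (k (t + 2 * h) - 2 * c * k (t + h) + c ^ 2 * k t)
      + (k (t + h) - k (t + 2 * h)) * (1 / (n : ℝ))) atTop
      (𝓝 ((k (t + 2 * h) - 2 * c * k (t + h) + c ^ 2 * k t)
      + (k (t + h) - k (t + 2 * h)) * 0)) :=
    (tendsto_one_div_atTop_nhds_zero_nat.const_mul _).const_add _
  rw [mul_zero, add_zero] at hlim
  exact ge_of_tendsto hlim ((eventually_gt_atTop 0).mono key)

/-! ### Kaluza's theorem -/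

/-- The coefficients `b` determined by `a (n + 1) = ∑_{i + j = n} b i * a j`. -/
noncomputable def renewalCoeff (a : ℕ → ℝ) (n : ℕ) : ℝ :=
  PowerSeries.coeff n (PowerSeries.mk (fun n => a (n + 1)) * (PowerSeries.mk a)⁻¹)

theorem sum_renewalCoeff_mul {a : ℕ → ℝ} (ha : a 0 ≠ 0) (n : ℕ) :
    ∑ x ∈ Finset.HasAntidiagonal.antidiagonal n, renewalCoeff a x.1 * a x.2 = a (n + 1) := by
  have h : PowerSeries.mk (fun n => a (n + 1)) * (PowerSeries.mk a)⁻¹ * PowerSeries.mk a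
      = PowerSeries.mk (fun n => a (n + 1)) := by
    rw [mul_assoc, PowerSeries.inv_mul_cancel _ (by simpa using ha), mul_one]
  have := congrArg (PowerSeries.coeff n) h
  rw [PowerSeries.coeff_mul] at this
  simpa [renewalCoeff] using this

/-- Kaluza's theorem: log-convexity makes the renewal coefficients nonnegative. -/
theorem renewalCoeff_nonneg {a : ℕ → ℝ} (ha : ∀ n, 0 < a n)
    (hc : ∀ n, a (n + 1) ^ 2 ≤ a n * a (n + 2)) (n : ℕ) : 0 ≤ renewalCoeff a n := by
  have hr : Monotone fun n => a (n + 1) / a n := by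
    refine monotone_nat_of_le_succ fun n => ?_
    rw [div_le_div_iff₀ (ha _) (ha _)]
    nlinarith [hc n]
  induction n using Nat.strong_induction_on with
  | _ n ih =>
    cases n with
    | zero =>
      have := sum_renewalCoeff_mul (ha 0).ne' 0
      rw [Finset.Nat.antidiagonal_zero, Finset.sum_singleton] at this
      exact nonneg_of_mul_nonneg_left (this ▸ (ha 1).le) (ha 0)
    | succ n =>
      have h1 := sum_renewalCoeff_mul (ha 0).ne' (n + 1)
      have h0 := sum_renewalCoeff_mul (ha 0).ne' n
      rw [Finset.Nat.sum_antidiagonal_succ'] at h1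
      -- Since the ratios `a (j+1) / a j` increase, the terms with old coefficients contribute at
      -- most `a (n+1) * (a (n+2) / a (n+1)) = a (n+2)`, so the new term `b (n+1) * a 0` is
      -- nonnegative.
      have h2 : ∑ x ∈ Finset.HasAntidiagonal.antidiagonal n, renewalCoeff a x.1 * a (x.2 + 1)
          ≤ ∑ x ∈ Finset.HasAntidiagonal.antidiagonal n,
            renewalCoeff a x.1 * a x.2 * (a (n + 2) / a (n + 1)) := by
        refine Finset.sum_le_sum fun x hx => ?_
        have hx' := Finset.HasAntidiagonal.mem_antidiagonal.1 hx
        rw [mul_assoc]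
        refine mul_le_mul_of_nonneg_left ?_ (ih x.1 (by omega))
        have := hr (show x.2 ≤ n + 1 by omega)
        simp only at this
        rw [div_le_iff₀ (ha _)] at this
        linarith
      rw [← Finset.sum_mul, h0, mul_div_cancel₀ _ (ha (n + 1)).ne'] at h2
      have h3 : 0 ≤ renewalCoeff a (n + 1) * a 0 := by
        simp only at h1
        linarith
      exact nonneg_of_mul_nonneg_left h3 (ha 0)

/-- The recursion says `z B(z) A(z) = A(z) - a 0`. The bound `b n * a 0 ≤ a (n+1)` gives the
absolute convergence that the Cauchy product needs. -/
theorem hasSum_renewalCoeff {a : ℕ → ℝ} (ha : ∀ n, 0 < a n)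
    (hc : ∀ n, a (n + 1) ^ 2 ≤ a n * a (n + 2)) {z : ℝ} (hz : 0 < z)
    (hs : Summable fun n => a n * z ^ n) :
    HasSum (fun n => renewalCoeff a n * z ^ (n + 1)) (1 - a 0 / ∑' n, a n * z ^ n) := by
  have hb := renewalCoeff_nonneg ha hc
  have hle : ∀ n, renewalCoeff a n * a 0 ≤ a (n + 1) := by
    intro n
    rw [← sum_renewalCoeff_mul (ha 0).ne' n]
    exact Finset.single_le_sum (f := fun x : ℕ × ℕ => renewalCoeff a x.1 * a x.2)
      (fun x _ => mul_nonneg (hb _) (ha _).le) (a := (n, 0)) (by simp)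
  have hs1 : Summable fun n => a (n + 1) * z ^ (n + 1) := (summable_nat_add_iff 1).2 hs
  have hsb : Summable fun n => renewalCoeff a n * z ^ (n + 1) := by
    refine Summable.of_nonneg_of_le (fun n => mul_nonneg (hb n) (by positivity)) (fun n => ?_)
      (hs1.mul_left (a 0)⁻¹)
    rw [← mul_assoc, inv_mul_eq_div]
    refine mul_le_mul_of_nonneg_right ?_ (by positivity)
    rw [le_div_iff₀ (ha 0)]
    exact hle n
  have hA : 0 < ∑' n, a n * z ^ n :=
    hs.tsum_pos (fun n => mul_nonneg (ha n).le (by positivity)) 0 (by simpa using ha 0)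
  have hmul := tsum_mul_tsum_eq_tsum_sum_antidiagonal_of_summable_norm hsb.norm hs.norm
  have hconv : ∀ n, ∑ x ∈ Finset.HasAntidiagonal.antidiagonal n,
      renewalCoeff a x.1 * z ^ (x.1 + 1) * (a x.2 * z ^ x.2) = a (n + 1) * z ^ (n + 1) := by
    intro n
    rw [← sum_renewalCoeff_mul (ha 0).ne' n, Finset.sum_mul]
    refine Finset.sum_congr rfl fun x hx => ?_
    rw [← Finset.HasAntidiagonal.mem_antidiagonal.1 hx]
    ring
  simp only [hconv] at hmul
  have hsplit := hs.tsum_eq_zero_add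
  rw [← hmul] at hsplit
  have : ∑' n, renewalCoeff a n * z ^ (n + 1) = 1 - a 0 / ∑' n, a n * z ^ n := by
    rw [eq_sub_iff_add_eq, ← eq_sub_iff_add_eq', eq_comm, eq_div_iff hA.ne']
    simp only [pow_zero, mul_one] at hsplit
    linarith
  exact this ▸ hsb.hasSum

end RayleighStokes

namespace RayleighStokes

open Filter Topology unitInterval

/-! ### Laplace transforms of probability measures on `[0, ∞]`, in the variable `x = e^{-t}` -/

/-- `F(λ) = ∫ x^λ dμ(x)` for `λ > 0`. -/
def HasPowerTransform (μ : Measure I) (F : ℝ → ℝ) : Prop :=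
  ∀ lam : ℝ, 0 < lam → ∫ x : I, (x : ℝ) ^ lam ∂μ = F lam

/-- `F` is the Laplace transform of a probability measure on `[0, ∞]`. -/
def IsPowerTransform (F : ℝ → ℝ) : Prop :=
  ∃ μ : ProbabilityMeasure I, HasPowerTransform (μ : Measure I) F

theorem continuous_rpow_unitInterval {lam : ℝ} (h : 0 < lam) :
    Continuous fun x : I => (x : ℝ) ^ lam :=
  continuous_subtype_val.rpow_const fun _ => Or.inr h.le

theorem integrable_rpow_unitInterval {lam : ℝ} (h : 0 < lam) (μ : Measure I)
    [IsFiniteMeasure μ] : Integrable (fun x : I => (x : ℝ) ^ lam) μ :=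
  (continuous_rpow_unitInterval h).integrable_of_hasCompactSupport
    (HasCompactSupport.of_compactSpace _)

theorem IsPowerTransform.exp {s : ℝ} (hs : 0 ≤ s) :
    IsPowerTransform fun lam => Real.exp (-(lam * s)) := by
  refine ⟨⟨Measure.dirac ⟨Real.exp (-s), (Real.exp_pos _).le, Real.exp_le_one_iff.2 (by linarith)⟩,
    inferInstance⟩, fun lam _ => ?_⟩
  simp only [ProbabilityMeasure.coe_mk, integral_dirac]
  rw [← Real.exp_mul]
  ring_nf

/-- Multiplying independent variables in `x` is adding them in `t = -log x`. -/
theorem IsPowerTransform.mul {F G : ℝ → ℝ} (hF : IsPowerTransform F) (hG : IsPowerTransform G) :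
    IsPowerTransform fun lam => F lam * G lam := by
  obtain ⟨μ, hμ⟩ := hF
  obtain ⟨ν, hν⟩ := hG
  have hm : Measurable fun x : I × I => x.1 * x.2 := by fun_prop
  refine ⟨(μ.prod ν).map hm.aemeasurable, fun lam hlam => ?_⟩
  rw [ProbabilityMeasure.toMeasure_map, integral_map hm.aemeasurable
    (continuous_rpow_unitInterval hlam).aestronglyMeasurable]
  simp only [ProbabilityMeasure.toMeasure_prod, Set.Icc.coe_mul]
  rw [← hμ lam hlam, ← hν lam hlam, ← integral_prod_mul]
  exact integral_congr_ae (Eventually.of_forall fun x => Real.mul_rpow x.1.2.1 x.2.2.1)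

theorem IsPowerTransform.one : IsPowerTransform fun _ => 1 := by
  simpa using IsPowerTransform.exp le_rfl

theorem IsPowerTransform.pow {F : ℝ → ℝ} (hF : IsPowerTransform F) (n : ℕ) :
    IsPowerTransform fun lam => F lam ^ n := by
  induction n with
  | zero => simpa using IsPowerTransform.one
  | succ n ih => simpa only [pow_succ] using ih.mul hF

/-- Any missing mass is put at `x = 0`, invisible to `x^λ` with `λ > 0`. -/
theorem IsPowerTransform.finset_sum {ι : Type*} (s : Finset ι) {c : ι → ℝ} {F : ι → ℝ → ℝ}
    (hc : ∀ i, 0 ≤ c i) (hs : ∑ i ∈ s, c i ≤ 1) (hF : ∀ i, IsPowerTransform (F i)) :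
    IsPowerTransform fun lam => ∑ i ∈ s, c i * F i lam := by
  choose μ hμ using hF
  set ν : Measure I := ∑ i ∈ s, ENNReal.ofReal (c i) • (μ i : Measure I)
    + ENNReal.ofReal (1 - ∑ i ∈ s, c i) • Measure.dirac 0 with hν
  have hprob : IsProbabilityMeasure ν := by
    constructor
    simp only [hν, Measure.coe_add, Measure.coe_finsetSum, Measure.coe_smul, Pi.add_apply,
      Finset.sum_apply, Pi.smul_apply, measure_univ, smul_eq_mul, mul_one]
    rw [← ENNReal.ofReal_sum_of_nonneg fun i _ => hc i, ← ENNReal.ofReal_add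
      (Finset.sum_nonneg fun i _ => hc i) (by linarith), add_sub_cancel, ENNReal.ofReal_one]
  refine ⟨⟨ν, hprob⟩, fun lam hlam => ?_⟩
  rw [ProbabilityMeasure.coe_mk, hν, integral_add_measure, integral_finsetSum_measure]
  · simp only [integral_smul_measure, integral_dirac, hμ _ lam hlam, Set.Icc.coe_zero,
      Real.zero_rpow hlam.ne', smul_eq_mul, mul_zero, add_zero]
    exact Finset.sum_congr rfl fun i _ => by rw [ENNReal.toReal_ofReal (hc i)]
  · exact fun i _ => (integrable_rpow_unitInterval hlam _).smul_measure ENNReal.ofReal_ne_top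
  · exact integrable_finsetSum_measure.2 fun i _ =>
      (integrable_rpow_unitInterval hlam _).smul_measure ENNReal.ofReal_ne_top
  · exact (integrable_rpow_unitInterval hlam _).smul_measure ENNReal.ofReal_ne_top

/-- Probability measures on a compact space are compact, so the laws converge along an ultrafilter.
No condition at `λ = 0` is needed: mass escaping to `t = ∞` is kept at `x = 0`. -/
theorem IsPowerTransform.of_tendsto {ι : Type*} {l : Filter ι} [l.NeBot] {F : ι → ℝ → ℝ}
    {G : ℝ → ℝ} (hF : ∀ᶠ i in l, IsPowerTransform (F i))
    (h : ∀ lam, 0 < lam → Tendsto (fun i => F i lam) l (𝓝 (G lam))) : IsPowerTransform G := by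
  classical
  let μ : ι → ProbabilityMeasure I := fun i =>
    if hi : IsPowerTransform (F i) then hi.choose else ⟨Measure.dirac 0, inferInstance⟩
  have hμ : ∀ᶠ i in l, HasPowerTransform (μ i : Measure I) (F i) := by
    filter_upwards [hF] with i hi
    rw [show μ i = hi.choose from dif_pos hi]
    exact hi.choose_spec
  let U := Ultrafilter.of l
  have hU : Tendsto μ U (𝓝 (U.map μ).lim) := Ultrafilter.le_nhds_lim (U.map μ)
  refine ⟨(U.map μ).lim, fun lam hlam => ?_⟩
  have h1 := (ProbabilityMeasure.tendsto_iff_forall_integral_tendsto.1 hU)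
    (BoundedContinuousFunction.mkOfCompact ⟨_, continuous_rpow_unitInterval hlam⟩)
  have h2 : Tendsto (fun i => ∫ x : I, (x : ℝ) ^ lam ∂(μ i : Measure I)) U (𝓝 (G lam)) := by
    refine ((h lam hlam).mono_left (Ultrafilter.of_le l)).congr' ?_
    filter_upwards [hμ.filter_mono (Ultrafilter.of_le l)] with i hi using (hi lam hlam).symm
  exact tendsto_nhds_unique h1 h2

theorem IsPowerTransform.of_hasSum {c : ℕ → ℝ} {F : ℕ → ℝ → ℝ} {G : ℝ → ℝ}
    (hc : ∀ i, 0 ≤ c i) (hs : ∀ N, ∑ i ∈ Finset.range N, c i ≤ 1)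
    (hF : ∀ i, IsPowerTransform (F i))
    (hG : ∀ lam, 0 < lam → HasSum (fun i => c i * F i lam) (G lam)) : IsPowerTransform G :=
  .of_tendsto (Eventually.of_forall fun N => .finset_sum (Finset.range N) hc (hs N) hF)
    fun lam hlam => (hG lam hlam).tendsto_sum_nat

/-- If `1 - c φ` is a Laplace transform for arbitrarily small `c > 0`, then so is `e^{-τφ}`. -/
theorem IsPowerTransform.exp_of_one_sub {φ : ℝ → ℝ} {c₀ : ℝ} (hc₀ : 0 < c₀)
    (h : ∀ c, 0 ≤ c → c ≤ c₀ → IsPowerTransform fun lam => 1 - c * φ lam) {τ : ℝ} (hτ : 0 ≤ τ) :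
    IsPowerTransform fun lam => Real.exp (-(τ * φ lam)) := by
  have h0 : ∀ᶠ n : ℕ in atTop, τ / (n : ℝ) ≤ c₀ :=
    (tendsto_const_div_atTop_nhds_zero_nat τ).eventually_le_const hc₀
  refine .of_tendsto (l := atTop) (F := fun (n : ℕ) lam => (1 - τ / n * φ lam) ^ n) ?_ ?_
  · filter_upwards [h0] with n hn using (h _ (by positivity) hn).pow n
  · intro lam _
    refine (Real.tendsto_one_add_div_pow_exp (-(τ * φ lam))).congr fun n => ?_
    congr 1
    ring

/-! ### Uniqueness of moments on the unit interval -/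

/-- Weierstrass: polynomials are dense in `C(I, ℝ)`, and integration is continuous there. -/
theorem ext_of_moments {μ ν : Measure I} [IsFiniteMeasure μ] [IsFiniteMeasure ν]
    (h : ∀ n : ℕ, ∫ x : I, (x : ℝ) ^ n ∂μ = ∫ x : I, (x : ℝ) ^ n ∂ν) : μ = ν := by
  have hint : ∀ (ρ : Measure I) [IsFiniteMeasure ρ] (g : C(I, ℝ)), Integrable g ρ := fun ρ _ g =>
    g.continuous.integrable_of_hasCompactSupport (HasCompactSupport.of_compactSpace _)
  have hcont : ∀ (ρ : Measure I) [IsFiniteMeasure ρ], Continuous fun g : C(I, ℝ) => ∫ x, g x ∂ρ := by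
    intro ρ _
    have := (ContinuousMap.toLp (E := ℝ) 1 ρ ℝ).continuous
    refine ((continuous_integral (μ := ρ) (G := ℝ)).comp
      this).congr fun g => ?_
    exact integral_congr_ae (ContinuousMap.coeFn_toLp ρ g)
  refine ext_of_forall_integral_eq_of_IsFiniteMeasure fun f => ?_
  have hclosed : IsClosed {g : C(I, ℝ) | ∫ x, g x ∂μ = ∫ x, g x ∂ν} :=
    isClosed_eq (hcont μ) (hcont ν)
  have hsub : ((polynomialFunctions I : Subalgebra ℝ C(I, ℝ)) : Set C(I, ℝ)) ⊆
      {g : C(I, ℝ) | ∫ x, g x ∂μ = ∫ x, g x ∂ν} := by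
    rintro _ ⟨p, -, rfl⟩
    simp only [mem_ofPred_eq]
    induction p using Polynomial.induction_on' with
    | add p q hp hq =>
      simp only [AlgHom.coe_toRingHom, map_add, ContinuousMap.add_apply] at *
      rw [integral_add (hint _ _) (hint _ _), integral_add (hint _ _) (hint _ _), hp, hq]
    | monomial n c =>
      simp [Polynomial.toContinuousMapOn, integral_const_mul, h n]
  have hd : f.toContinuousMap ∈
      closure ((polynomialFunctions I : Subalgebra ℝ C(I, ℝ)) : Set C(I, ℝ)) := by
    have := congrArg (fun A : Subalgebra ℝ C(I, ℝ) => f.toContinuousMap ∈ A)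
      polynomialFunctions_closure_eq_top'
    simpa [← SetLike.mem_coe, Subalgebra.topologicalClosure_coe] using this
  exact hclosed.closure_subset_iff.2 hsub hd

end RayleighStokes

namespace RayleighStokes

open Filter Topology unitInterval

/-! ### The Laplace exponent of a completely monotone kernel -/

/-- For `0 ≤ c ≤ a 0`, Kaluza's theorem expands `1 - c / A(e^{-λh})` as `(1 - c / a 0) + (c / a 0) ∑
b n e^{-λ(n+1)h}`, a combination of exponentials with nonnegative weights of total at most `1`. -/
theorem isPowerTransform_exp_of_logConvex {a : ℕ → ℝ} (ha : ∀ n, 0 < a n)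
    (hc : ∀ n, a (n + 1) ^ 2 ≤ a n * a (n + 2)) {h : ℝ} (hh : 0 ≤ h)
    (hs : ∀ lam, 0 < lam → Summable fun n : ℕ => a n * Real.exp (-(lam * h)) ^ n)
    {τ : ℝ} (hτ : 0 ≤ τ) :
    IsPowerTransform fun lam =>
      Real.exp (-(τ * (1 / ∑' n : ℕ, a n * Real.exp (-(lam * h)) ^ n))) := by
  have hb := renewalCoeff_nonneg ha hc
  have hB := fun lam (hl : 0 < lam) =>
    hasSum_renewalCoeff ha hc (Real.exp_pos (-(lam * h))) (hs lam hl)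
  have hA : ∀ lam, 0 < lam → 0 < ∑' n : ℕ, a n * Real.exp (-(lam * h)) ^ n := fun lam hl =>
    (hs lam hl).tsum_pos (fun n => mul_nonneg (ha n).le (by positivity)) 0 (by simpa using ha 0)
  -- For `λ > 0` the full series is at most `1`; in a finite partial sum `λ ↓ 0` is harmless.
  have hb1 : ∀ N, ∑ n ∈ Finset.range N, renewalCoeff a n ≤ 1 := by
    intro N
    have hcont : Continuous fun lam : ℝ =>
        ∑ n ∈ Finset.range N, renewalCoeff a n * Real.exp (-(lam * h)) ^ (n + 1) := by fun_prop
    have hlim := (hcont.tendsto 0).mono_left (nhdsWithin_le_nhds (s := Ioi 0))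
    simp only [zero_mul, neg_zero, Real.exp_zero, one_pow, mul_one] at hlim
    refine le_of_tendsto hlim ?_
    filter_upwards [self_mem_nhdsWithin] with lam hl
    refine (sum_le_hasSum _ (fun n _ => mul_nonneg (hb n) (by positivity)) (hB lam hl)).trans ?_
    have : 0 ≤ a 0 / ∑' n : ℕ, a n * Real.exp (-(lam * h)) ^ n :=
      div_nonneg (ha 0).le (hA lam hl).le
    linarith
  refine IsPowerTransform.exp_of_one_sub (ha 0) (fun c hc0 hca => ?_) hτ
  have hc1 : c / a 0 ≤ 1 := (div_le_one (ha 0)).2 hca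
  have hc2 : 0 ≤ c / a 0 := div_nonneg hc0 (ha 0).le
  let C : ℕ → ℝ := fun n => Nat.casesOn n (1 - c / a 0) fun n => c / a 0 * renewalCoeff a n
  refine IsPowerTransform.of_hasSum (c := C) (F := fun n lam => Real.exp (-(lam * (n * h)))) ?_ ?_
    (fun n => .exp (by positivity)) ?_
  · rintro (_ | n)
    · exact sub_nonneg.2 hc1
    · exact mul_nonneg hc2 (hb n)
  · rintro (_ | N)
    · simp
    · rw [Finset.sum_range_succ']
      change ∑ n ∈ Finset.range N, c / a 0 * renewalCoeff a n + (1 - c / a 0) ≤ 1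
      rw [← Finset.mul_sum]
      nlinarith [mul_le_mul_of_nonneg_left (hb1 N) hc2]
  · intro lam hl
    refine (hasSum_nat_add_iff' 1).1 ?_
    have e1 : (fun n : ℕ => C (n + 1) * Real.exp (-(lam * ((n + 1 : ℕ) * h)))) =
        fun n => c / a 0 * (renewalCoeff a n * Real.exp (-(lam * h)) ^ (n + 1)) := by
      funext n
      rw [← Real.exp_nat_mul, show ((n + 1 : ℕ) : ℝ) * -(lam * h) =
        -(lam * ((n + 1 : ℕ) * h)) by ring]
      exact mul_assoc _ _ _
    have e2 : 1 - c * (1 / ∑' n : ℕ, a n * Real.exp (-(lam * h)) ^ n) - ∑ i ∈ Finset.range 1,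
        C i * Real.exp (-(lam * ((i : ℕ) * h))) =
        c / a 0 * (1 - a 0 / ∑' n : ℕ, a n * Real.exp (-(lam * h)) ^ n) := by
      have ha0 := (ha 0).ne'
      have hA0 := (hA lam hl).ne'
      rw [Finset.sum_range_one]
      change _ - (1 - c / a 0) * _ = _
      rw [Nat.cast_zero, zero_mul, mul_zero, neg_zero, Real.exp_zero]
      field_simp
      ring
    rw [e1, e2]
    exact (hB lam hl).mul_left (c / a 0)

section kernel

variable {k : ℝ → ℝ}

theorem IsCompletelyMonotone.measurable_restrict (hk : IsCompletelyMonotone k) :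
    AEStronglyMeasurable k (volume.restrict (Ioi 0)) :=
  hk.1.continuousOn.aestronglyMeasurable measurableSet_Ioi

theorem integrableOn_exp_neg_mul_Ioi {lam : ℝ} (hl : 0 < lam) (s : ℝ) :
    IntegrableOn (fun t => Real.exp (-(lam * t))) (Ioi s) := by
  simpa only [neg_mul] using integrableOn_exp_mul_Ioi (neg_lt_zero.2 hl) s

theorem integrableOn_laplace (hk : IsCompletelyMonotone k) (hi : IsLocallyIntegrableKernel k)
    {lam : ℝ} (hl : 0 < lam) :
    IntegrableOn (fun t => Real.exp (-(lam * t)) * (1 + k t)) (Ioi 0) := by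
  have h1 := integrableOn_exp_neg_mul_Ioi hl 0
  have hm : AEStronglyMeasurable (fun t => Real.exp (-(lam * t)) * k t) (volume.restrict (Ioi 0)) :=
    (by fun_prop : Continuous fun t => Real.exp (-(lam * t))).aestronglyMeasurable.mul
      hk.measurable_restrict
  have h2 : IntegrableOn (fun t => Real.exp (-(lam * t)) * k t) (Ioi 0) := by
    rw [← Ioc_union_Ioi_eq_Ioi zero_le_one]
    refine IntegrableOn.union ?_ ?_
    · refine Integrable.mono (hi 1 one_pos)
        (hm.mono_measure (Measure.restrict_mono Ioc_subset_Ioi_self le_rfl)) ?_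
      filter_upwards [ae_restrict_mem measurableSet_Ioc] with t ht
      rw [norm_mul, Real.norm_eq_abs, Real.abs_exp]
      exact mul_le_of_le_one_left (norm_nonneg _)
        (Real.exp_le_one_iff.2 (neg_nonpos.2 (mul_pos hl ht.1).le))
    · refine Integrable.mono ((integrableOn_exp_neg_mul_Ioi hl 1).mul_const (k 1))
        (hm.mono_measure (Measure.restrict_mono (Ioi_subset_Ioi zero_le_one) le_rfl)) ?_
      filter_upwards [ae_restrict_mem measurableSet_Ioi] with t ht
      have ht0 : (0 : ℝ) < t := zero_lt_one.trans ht
      rw [norm_mul, norm_mul, Real.norm_of_nonneg (hk.nonneg ht0),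
        Real.norm_of_nonneg (hk.nonneg one_pos)]
      exact mul_le_mul_of_nonneg_left (hk.antitoneOn (mem_Ioi.2 one_pos) ht0 (le_of_lt ht)) (norm_nonneg _)
  simp only [mul_add, mul_one]
  exact Integrable.add h1 h2

/-! ### Discretisation of the kernel on a grid -/

theorem integrableOn_kernel (hi : IsLocallyIntegrableKernel k) {x y : ℝ} (hx : 0 ≤ x) :
    IntegrableOn (fun t => 1 + k t) (Ioc x y) := by
  refine (integrableOn_const (by simp)).add ((hi (max y 1) (by positivity)).mono_set ?_)
  exact Ioc_subset_Ioc hx (le_max_left _ _)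

/-- The integrals of `1 + k` over the cells of the grid `hℕ`. -/
noncomputable def cellIntegral (k : ℝ → ℝ) (h : ℝ) (n : ℕ) : ℝ :=
  ∫ t in Ioc (n * h) ((n + 1 : ℕ) * h), (1 + k t)

theorem cellIntegral_eq (k : ℝ → ℝ) {h : ℝ} (hh : 0 < h) (n : ℕ) :
    cellIntegral k h n = ∫ s in Ioc 0 h, (1 + k (s + n * h)) := by
  rw [cellIntegral, ← intervalIntegral.integral_of_le hh.le, ← intervalIntegral.integral_of_le
    (by push_cast; linarith), intervalIntegral.integral_comp_add_right (fun t => 1 + k t)]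
  push_cast
  ring_nf

theorem integrableOn_cell (hi : IsLocallyIntegrableKernel k) {h : ℝ} (hh : 0 < h) (n : ℕ) :
    IntegrableOn (fun s => 1 + k (s + n * h)) (Ioc 0 h) := by
  have h1 : IntervalIntegrable (fun t => 1 + k t) volume (0 + n * h) (h + n * h) :=
    (intervalIntegrable_iff_integrableOn_Ioc_of_le (by linarith)).2
      (integrableOn_kernel hi (by positivity))
  have h2 := h1.comp_add_right (n * h)
  rw [add_sub_cancel_right, add_sub_cancel_right] at h2
  exact (intervalIntegrable_iff_integrableOn_Ioc_of_le hh.le).1 h2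

theorem cellIntegral_pos (hk : IsCompletelyMonotone k) (hi : IsLocallyIntegrableKernel k) {h : ℝ}
    (hh : 0 < h) (n : ℕ) : 0 < cellIntegral k h n := by
  rw [cellIntegral_eq k hh]
  have h1 : ∫ _ in Ioc 0 h, (1 : ℝ) ≤ ∫ s in Ioc 0 h, (1 + k (s + n * h)) := by
    refine setIntegral_mono_on (integrableOn_const (by simp)) (integrableOn_cell hi hh n)
      measurableSet_Ioc fun s hs => ?_
    have := hk.nonneg (t := s + n * h) (add_pos_of_pos_of_nonneg hs.1 (by positivity))
    linarith
  refine lt_of_lt_of_le ?_ h1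
  simp [hh, hh.le]

/-- The quadratic inequality for `k`, plus `(c - 1)^2` from the summand `1`, is integrated over a
cell for each `c`. The minimiser `c = a (n+1) / a n` then gives log-convexity. -/
theorem cellIntegral_logConvex (hk : IsCompletelyMonotone k) (hi : IsLocallyIntegrableKernel k)
    {h : ℝ} (hh : 0 < h) (n : ℕ) :
    cellIntegral k h (n + 1) ^ 2 ≤ cellIntegral k h n * cellIntegral k h (n + 2) := by
  have hq : ∀ c : ℝ, 0 ≤ cellIntegral k h (n + 2) - 2 * c * cellIntegral k h (n + 1)
      + c ^ 2 * cellIntegral k h n := by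
    intro c
    have i1 := integrableOn_cell hi hh (n + 2)
    have i2 := (integrableOn_cell hi hh (n + 1)).const_mul (2 * c)
    have i3 := (integrableOn_cell hi hh n).const_mul (c ^ 2)
    rw [cellIntegral_eq k hh, cellIntegral_eq k hh, cellIntegral_eq k hh, ← integral_const_mul,
      ← integral_const_mul, ← integral_sub i1 i2]
    refine (integral_add (i1.sub i2) i3).subst (motive := fun x => 0 ≤ x) ?_
    refine setIntegral_nonneg measurableSet_Ioc fun s hs => ?_
    have := hk.quadratic_nonneg hh.le (t := s + n * h)
      (add_pos_of_pos_of_nonneg hs.1 (by positivity)) c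
    have e1 : s + ((n + 1 : ℕ) : ℝ) * h = s + n * h + h := by push_cast; ring
    have e2 : s + ((n + 2 : ℕ) : ℝ) * h = s + n * h + 2 * h := by push_cast; ring
    simp only [Pi.sub_apply]
    rw [e1, e2]
    nlinarith [sq_nonneg (c - 1)]
  have hp := cellIntegral_pos hk hi hh n
  have := hq (cellIntegral k h (n + 1) / cellIntegral k h n)
  have e : cellIntegral k h (n + 2) - 2 * (cellIntegral k h (n + 1) / cellIntegral k h n)
      * cellIntegral k h (n + 1) + (cellIntegral k h (n + 1) / cellIntegral k h n) ^ 2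
      * cellIntegral k h n = (cellIntegral k h n * cellIntegral k h (n + 2)
      - cellIntegral k h (n + 1) ^ 2) / cellIntegral k h n := by
    field_simp
    ring
  rw [e] at this
  have := mul_nonneg this hp.le
  rw [div_mul_cancel₀ _ hp.ne'] at this
  linarith

theorem iUnion_cell {h : ℝ} (hh : 0 < h) :
    ⋃ n : ℕ, Ioc ((n : ℝ) * h) ((n + 1 : ℕ) * h) = Ioi 0 := by
  have this := iUnion_Ioc_map_succ_eq_Ioi (f := fun n : ℕ => (n : ℝ) * h) (fun n => ?_)
    (not_bddAbove_of_tendsto_atTop (tendsto_natCast_atTop_atTop.atTop_mul_const hh))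
  · simpa using this
  · simpa using mul_nonneg n.cast_nonneg hh.le

theorem hasSum_laplace_cell (hk : IsCompletelyMonotone k) (hi : IsLocallyIntegrableKernel k)
    {h lam : ℝ} (hh : 0 < h) (hl : 0 < lam) :
    HasSum (fun n : ℕ => ∫ t in Ioc ((n : ℝ) * h) ((n + 1 : ℕ) * h),
      Real.exp (-(lam * t)) * (1 + k t)) (laplace (fun t => 1 + k t) lam) := by
  have hmono : Monotone fun n : ℕ => (n : ℝ) * h := fun m n hmn =>
    mul_le_mul_of_nonneg_right (by exact_mod_cast hmn) hh.le
  rw [laplace, ← iUnion_cell hh]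
  refine hasSum_integral_iUnion (fun n => measurableSet_Ioc) hmono.pairwise_disjoint_on_Ioc_succ ?_
  rw [iUnion_cell hh]
  exact integrableOn_laplace hk hi hl

/-- On the `n`-th cell `e^{-λt}` lies between `e^{-λ(n+1)h}` and `e^{-λnh}`. Summed over `n`, this
squeezes the generating function between the Laplace transform and `e^{λh}` times it. -/
theorem cell_bounds (hk : IsCompletelyMonotone k) (hi : IsLocallyIntegrableKernel k)
    {h lam : ℝ} (hh : 0 < h) (hl : 0 < lam) (n : ℕ) :
    ∫ t in Ioc ((n : ℝ) * h) ((n + 1 : ℕ) * h), Real.exp (-(lam * t)) * (1 + k t)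
        ≤ cellIntegral k h n * Real.exp (-(lam * h)) ^ n ∧
      cellIntegral k h n * Real.exp (-(lam * h)) ^ n ≤ Real.exp (lam * h) *
        ∫ t in Ioc ((n : ℝ) * h) ((n + 1 : ℕ) * h), Real.exp (-(lam * t)) * (1 + k t) := by
  have hn : (0 : ℝ) ≤ n * h := by positivity
  have hint := integrableOn_kernel hi (y := (n + 1 : ℕ) * h) hn
  have hint' : IntegrableOn (fun t => Real.exp (-(lam * t)) * (1 + k t))
      (Ioc ((n : ℝ) * h) ((n + 1 : ℕ) * h)) :=
    (integrableOn_laplace hk hi hl).mono_set fun t ht => hn.trans_lt ht.1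
  have hpos : ∀ t ∈ Ioc ((n : ℝ) * h) ((n + 1 : ℕ) * h), 0 ≤ 1 + k t := fun t ht =>
    add_nonneg zero_le_one (hk.nonneg (hn.trans_lt ht.1))
  rw [cellIntegral, ← integral_mul_const, ← integral_const_mul, ← Real.exp_nat_mul]
  refine ⟨setIntegral_mono_on hint' (hint.mul_const _) measurableSet_Ioc fun t ht => ?_,
    setIntegral_mono_on (hint.mul_const _) (hint'.const_mul _) measurableSet_Ioc fun t ht => ?_⟩
  · rw [mul_comm]
    refine mul_le_mul_of_nonneg_left (Real.exp_le_exp.2 ?_) (hpos t ht)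
    nlinarith [ht.1]
  · rw [← mul_assoc, ← Real.exp_add, mul_comm]
    refine mul_le_mul_of_nonneg_right (Real.exp_le_exp.2 ?_) (hpos t ht)
    have := ht.2
    push_cast at this
    nlinarith

theorem summable_cell (hk : IsCompletelyMonotone k) (hi : IsLocallyIntegrableKernel k)
    {h lam : ℝ} (hh : 0 < h) (hl : 0 < lam) :
    Summable fun n : ℕ => cellIntegral k h n * Real.exp (-(lam * h)) ^ n :=
  Summable.of_nonneg_of_le
    (fun n => mul_nonneg (cellIntegral_pos hk hi hh n).le (by positivity))
    (fun n => (cell_bounds hk hi hh hl n).2) ((hasSum_laplace_cell hk hi hh hl).summable.mul_left _)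

theorem laplace_le_tsum_cell (hk : IsCompletelyMonotone k) (hi : IsLocallyIntegrableKernel k)
    {h lam : ℝ} (hh : 0 < h) (hl : 0 < lam) :
    laplace (fun t => 1 + k t) lam ≤ ∑' n : ℕ, cellIntegral k h n * Real.exp (-(lam * h)) ^ n :=
  hasSum_le (fun n => (cell_bounds hk hi hh hl n).1) (hasSum_laplace_cell hk hi hh hl)
    (summable_cell hk hi hh hl).hasSum

theorem tsum_cell_le (hk : IsCompletelyMonotone k) (hi : IsLocallyIntegrableKernel k)
    {h lam : ℝ} (hh : 0 < h) (hl : 0 < lam) :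
    ∑' n : ℕ, cellIntegral k h n * Real.exp (-(lam * h)) ^ n
      ≤ Real.exp (lam * h) * laplace (fun t => 1 + k t) lam :=
  hasSum_le (fun n => (cell_bounds hk hi hh hl n).2) (summable_cell hk hi hh hl).hasSum
    ((hasSum_laplace_cell hk hi hh hl).mul_left _)

theorem laplace_kernel_pos (hk : IsCompletelyMonotone k) (hi : IsLocallyIntegrableKernel k)
    {lam : ℝ} (hl : 0 < lam) : 0 < laplace (fun t => 1 + k t) lam := by
  have h1 := (summable_cell hk hi one_pos hl).tsum_pos
    (fun n => mul_nonneg (cellIntegral_pos hk hi one_pos n).le (by positivity)) 0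
    (by simpa using cellIntegral_pos hk hi one_pos 0)
  exact pos_of_mul_pos_right (h1.trans_le (tsum_cell_le hk hi one_pos hl)) (Real.exp_pos _).le

theorem isPowerTransform_exp_laplaceExponent (hk : IsCompletelyMonotone k)
    (hi : IsLocallyIntegrableKernel k) {τ : ℝ} (hτ : 0 ≤ τ) :
    IsPowerTransform fun lam =>
      Real.exp (-(τ * laplaceExponent (fun t => 1 + k t) lam)) := by
  refine .of_tendsto (l := 𝓝[>] (0 : ℝ)) (F := fun h lam => Real.exp (-(τ *
    (1 / ∑' n : ℕ, cellIntegral k h n * Real.exp (-(lam * h)) ^ n)))) ?_ ?_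
  · filter_upwards [self_mem_nhdsWithin] with h hh
    exact isPowerTransform_exp_of_logConvex (cellIntegral_pos hk hi hh)
      (cellIntegral_logConvex hk hi hh) (le_of_lt hh) (fun lam hl => summable_cell hk hi hh hl) hτ
  · intro lam hl
    have hlim : Tendsto (fun h => ∑' n : ℕ, cellIntegral k h n * Real.exp (-(lam * h)) ^ n)
        (𝓝[>] (0 : ℝ)) (𝓝 (laplace (fun t => 1 + k t) lam)) := by
      have hup : Tendsto (fun h => Real.exp (lam * h) * laplace (fun t => 1 + k t) lam)
          (𝓝[>] (0 : ℝ)) (𝓝 (laplace (fun t => 1 + k t) lam)) := by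
        have hcont : Continuous fun h => Real.exp (lam * h) * laplace (fun t => 1 + k t) lam := by
          fun_prop
        simpa using (hcont.tendsto 0).mono_left (nhdsWithin_le_nhds (s := Ioi 0))
      refine tendsto_of_tendsto_of_tendsto_of_le_of_le' tendsto_const_nhds hup ?_ ?_
      · filter_upwards [self_mem_nhdsWithin] with h hh using laplace_le_tsum_cell hk hi hh hl
      · filter_upwards [self_mem_nhdsWithin] with h hh using tsum_cell_le hk hi hh hl
    rw [laplaceExponent, one_div]
    exact (Real.continuous_exp.tendsto _).comp
      ((((hlim.inv₀ (laplace_kernel_pos hk hi hl).ne').congr fun h => (one_div _).symm).const_mul τ).neg)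

end kernel

end RayleighStokes

namespace RayleighStokes

open Filter Topology unitInterval

/-! ### Distribution functions of laws on `[0, ∞]` -/

/-- `t ↦ μ{x > e^{-t}}`, the distribution function of `-log x`. -/
noncomputable def logDistribution (μ : Measure I) (t : ℝ) : ℝ :=
  μ.real {x : I | Real.exp (-t) < x}

theorem measurableSet_exp_lt (t : ℝ) : MeasurableSet {x : I | Real.exp (-t) < x} :=
  measurableSet_lt measurable_const measurable_subtype_coe

theorem logDistribution_eq_integral (μ : Measure I) (t : ℝ) :
    logDistribution μ t = ∫ x, {x : I | Real.exp (-t) < x}.indicator 1 x ∂μ := by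
  rw [integral_indicator_one (measurableSet_exp_lt t), logDistribution]

theorem logDistribution_nonneg (μ : Measure I) (t : ℝ) : 0 ≤ logDistribution μ t :=
  measureReal_nonneg

theorem logDistribution_le_one (μ : Measure I) [IsProbabilityMeasure μ] (t : ℝ) :
    logDistribution μ t ≤ 1 :=
  measureReal_le_one

theorem monotone_logDistribution (μ : Measure I) [IsFiniteMeasure μ] :
    Monotone (logDistribution μ) := fun s t hst =>
  measureReal_mono fun x hx => lt_of_le_of_lt (Real.exp_le_exp.2 (by linarith)) hx

theorem logDistribution_zero (μ : Measure I) : logDistribution μ 0 = 0 := by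
  have : {x : I | Real.exp (-0) < x} = ∅ := by
    ext x
    simpa using x.2.2
  rw [logDistribution, this, measureReal_empty]

/-- The strict inequality in `e^{-t} < x` makes the distribution function left-continuous. -/
theorem continuousWithinAt_logDistribution (μ : Measure I) [IsFiniteMeasure μ] (t : ℝ) :
    ContinuousWithinAt (logDistribution μ) (Iic t) t := by
  rw [show logDistribution μ = fun t => ∫ x, {x : I | Real.exp (-t) < x}.indicator 1 x ∂μ from
    funext (logDistribution_eq_integral μ)]
  refine tendsto_integral_filter_of_dominated_convergence (fun _ => 1)
    (Eventually.of_forall fun r =>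
      (measurable_one.indicator (measurableSet_exp_lt r)).aestronglyMeasurable)
    (Eventually.of_forall fun r => Eventually.of_forall fun x => ?_) (integrable_const _)
    (Eventually.of_forall fun x => ?_)
  · refine (norm_indicator_le_norm_self _ _).trans ?_
    simp
  · refine tendsto_const_nhds.congr' ?_
    by_cases hx : Real.exp (-t) < x
    · have hc : Continuous fun r : ℝ => Real.exp (-r) := by fun_prop
      filter_upwards [nhdsWithin_le_nhds (hc.continuousAt.eventually_lt_const hx)] with r hr
      rw [indicator_of_mem (show x ∈ {x : I | Real.exp (-t) < x} from hx),
        indicator_of_mem (show x ∈ {x : I | Real.exp (-r) < x} from hr)]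
    · filter_upwards [self_mem_nhdsWithin] with r hr
      rw [indicator_of_notMem (show x ∉ {x : I | Real.exp (-t) < x} from hx), indicator_of_notMem]
      intro h
      exact hx (lt_of_le_of_lt (Real.exp_le_exp.2 (neg_le_neg hr)) h)

theorem integral_exp_neg_mul_Ioi {lam : ℝ} (hl : 0 < lam) (s : ℝ) :
    ∫ t in Ioi s, Real.exp (-(lam * t)) = Real.exp (-(lam * s)) / lam := by
  have := integral_exp_mul_Ioi (neg_lt_zero.2 hl) s
  simp only [neg_mul] at this
  rw [this, neg_div_neg_eq]

theorem integral_exp_mul_indicator {lam : ℝ} (hl : 0 < lam) (x : I) :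
    ∫ t in Ioi (0 : ℝ), Real.exp (-(lam * t)) * {x : I | Real.exp (-t) < x}.indicator 1 x
      = (x : ℝ) ^ lam / lam := by
  rcases x.2.1.eq_or_lt with hx | hx
  · rw [← hx, Real.zero_rpow hl.ne', zero_div]
    refine integral_eq_zero_of_ae (Eventually.of_forall fun t => ?_)
    have : x ∉ {x : I | Real.exp (-t) < x} := fun h => by
      have h' : Real.exp (-t) < x := h
      rw [← hx] at h'
      exact absurd (Real.exp_pos (-t)) (not_lt.2 h'.le)
    simp [indicator_of_notMem this]
  · have h1 : ∀ t, Real.exp (-(lam * t)) * {x : I | Real.exp (-t) < x}.indicator 1 x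
        = (Ioi (-Real.log x)).indicator (fun t => Real.exp (-(lam * t))) t := by
      intro t
      have hiff : x ∈ {x : I | Real.exp (-t) < x} ↔ t ∈ Ioi (-Real.log x) := by
        change Real.exp (-t) < x ↔ -Real.log x < t
        rw [← Real.lt_log_iff_exp_lt hx, neg_lt]
      by_cases ht : t ∈ Ioi (-Real.log x)
      · rw [indicator_of_mem ht, indicator_of_mem (hiff.2 ht), Pi.one_apply, mul_one]
      · rw [indicator_of_notMem ht, indicator_of_notMem (mt hiff.1 ht), mul_zero]
    simp only [h1]
    have hlog : 0 ≤ -Real.log x := neg_nonneg.2 (Real.log_nonpos x.2.1 x.2.2)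
    rw [setIntegral_indicator measurableSet_Ioi, Ioi_inter_Ioi, sup_eq_right.2 hlog,
      integral_exp_neg_mul_Ioi hl, Real.rpow_def_of_pos hx]
    ring_nf

theorem integrable_exp_mul_logDistribution (μ : Measure I) [IsProbabilityMeasure μ] {lam : ℝ}
    (hl : 0 < lam) :
    IntegrableOn (fun t => Real.exp (-(lam * t)) * logDistribution μ t) (Ioi 0) := by
  refine Integrable.mono (integrableOn_exp_neg_mul_Ioi hl 0) ?_ (Eventually.of_forall fun t => ?_)
  · exact ((by fun_prop : Measurable fun t => Real.exp (-(lam * t))).mul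
      (monotone_logDistribution μ).measurable).aestronglyMeasurable
  · rw [norm_mul, Real.norm_of_nonneg (logDistribution_nonneg μ t)]
    exact mul_le_of_le_one_right (norm_nonneg _) (logDistribution_le_one μ t)

theorem laplace_logDistribution {μ : Measure I} [IsProbabilityMeasure μ] {F : ℝ → ℝ}
    (h : HasPowerTransform μ F) {lam : ℝ} (hl : 0 < lam) :
    laplace (logDistribution μ) lam = F lam / lam := by
  have hmeas : MeasurableSet {p : ℝ × I | Real.exp (-p.1) < p.2} :=
    measurableSet_lt (by fun_prop) (by fun_prop)
  have hint : Integrable (Function.uncurry fun (t : ℝ) (x : I) =>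
      Real.exp (-(lam * t)) * {x : I | Real.exp (-t) < x}.indicator (1 : I → ℝ) x)
      ((volume.restrict (Ioi 0)).prod μ) := by
    have h1 : Integrable (fun p : ℝ × I => Real.exp (-(lam * p.1)) * (1 : ℝ))
        ((volume.restrict (Ioi 0)).prod μ) :=
      Integrable.mul_prod (integrableOn_exp_neg_mul_Ioi hl 0) (integrable_const (1 : ℝ))
    refine h1.mono ?_ (Eventually.of_forall fun p => ?_)
    · refine Measurable.aestronglyMeasurable ?_
      exact (by fun_prop : Measurable fun p : ℝ × I => Real.exp (-(lam * p.1))).mul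
        (measurable_one.indicator hmeas)
    · rw [Function.uncurry, norm_mul, norm_mul]
      refine mul_le_mul_of_nonneg_left ?_ (norm_nonneg _)
      exact (norm_indicator_le_norm_self _ _).trans (by simp)
  have h2 : ∀ t, Real.exp (-(lam * t)) * logDistribution μ t = ∫ x : I,
      Real.exp (-(lam * t)) * {x : I | Real.exp (-t) < x}.indicator 1 x ∂μ := fun t => by
    rw [logDistribution_eq_integral, integral_const_mul]
  rw [laplace]
  simp only [h2]
  rw [integral_integral_swap hint]
  simp only [integral_exp_mul_indicator hl]
  rw [integral_div, h lam hl]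

theorem isPropagationFunction_logDistribution {m : ℝ → ℝ} {μ : ℝ → Measure I}
    [∀ τ, IsProbabilityMeasure (μ τ)]
    (h : ∀ τ, 0 ≤ τ → HasPowerTransform (μ τ) fun lam => Real.exp (-(τ * laplaceExponent m lam))) :
    IsPropagationFunction m fun t τ => logDistribution (μ τ) t := fun τ hτ =>
  ⟨(monotone_logDistribution _).monotoneOn _, logDistribution_zero _,
    fun t _ => continuousWithinAt_logDistribution _ t,
    fun _ hl => ⟨integrable_exp_mul_logDistribution _ hl, laplace_logDistribution (h τ hτ) hl⟩⟩

/-! ### Uniqueness of the propagation function -/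

/-- The point `e^{-t}` of the unit interval. -/
noncomputable def expNegI (t : ℝ) : I :=
  ⟨Real.exp (-max t 0), (Real.exp_pos _).le, Real.exp_le_one_iff.2 (by simp)⟩

theorem measurable_expNegI : Measurable expNegI :=
  Measurable.subtype_mk (by fun_prop)

/-- The measure `e^{-t} g(t) dt` is finite, and its image under `x = e^{-t}` has as `n`-th moment
the Laplace transform of `g` at `n + 1`. Moments determine the image, and `-log x` transports the
equality back. -/
theorem ae_eq_of_laplace_eq {g₁ g₂ : ℝ → ℝ} (hp₁ : ∀ t, 0 < t → 0 ≤ g₁ t)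
    (hp₂ : ∀ t, 0 < t → 0 ≤ g₂ t)
    (hi₁ : ∀ lam, 0 < lam → IntegrableOn (fun t => Real.exp (-(lam * t)) * g₁ t) (Ioi 0))
    (hi₂ : ∀ lam, 0 < lam → IntegrableOn (fun t => Real.exp (-(lam * t)) * g₂ t) (Ioi 0))
    (h : ∀ lam, 0 < lam → laplace g₁ lam = laplace g₂ lam) :
    ∀ᵐ t ∂(volume.restrict (Ioi (0 : ℝ))), g₁ t = g₂ t := by
  have key : ∀ g : ℝ → ℝ, (∀ t, 0 < t → 0 ≤ g t) →
      (∀ lam, 0 < lam → IntegrableOn (fun t => Real.exp (-(lam * t)) * g t) (Ioi 0)) →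
      ∀ n : ℕ, ∫ x : I, (x : ℝ) ^ n ∂(((volume.restrict (Ioi (0 : ℝ))).withDensity fun t =>
        ENNReal.ofReal (Real.exp (-(1 * t)) * g t)).map expNegI) = laplace g (n + 1) := by
    intro g hp hi n
    rw [integral_map measurable_expNegI.aemeasurable (by fun_prop),
      integral_withDensity_eq_integral_toReal_smul₀
        (hi 1 one_pos).1.aemeasurable.ennreal_ofReal (by simp), laplace]
    refine setIntegral_congr_fun measurableSet_Ioi fun t ht => ?_
    simp only [expNegI, max_eq_left (le_of_lt (mem_Ioi.1 ht)), smul_eq_mul]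
    rw [ENNReal.toReal_ofReal (mul_nonneg (Real.exp_pos _).le (hp t ht)), ← Real.exp_nat_mul,
      mul_right_comm, ← Real.exp_add]
    ring_nf
  have hfin : ∀ g : ℝ → ℝ,
      (∀ lam, 0 < lam → IntegrableOn (fun t => Real.exp (-(lam * t)) * g t) (Ioi 0)) →
      IsFiniteMeasure ((volume.restrict (Ioi (0 : ℝ))).withDensity fun t =>
        ENNReal.ofReal (Real.exp (-(1 * t)) * g t)) := fun g hi =>
    isFiniteMeasure_withDensity_ofReal (hi 1 one_pos).2
  have := hfin g₁ hi₁
  have := hfin g₂ hi₂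
  have hmap := ext_of_moments fun n => (key g₁ hp₁ hi₁ n).trans
    ((h _ (by positivity)).trans (key g₂ hp₂ hi₂ n).symm)
  have hlog : Measurable fun x : I => -Real.log x := by fun_prop
  have hinv : ∀ g : ℝ → ℝ, ((((volume.restrict (Ioi (0 : ℝ))).withDensity fun t =>
      ENNReal.ofReal (Real.exp (-(1 * t)) * g t)).map expNegI).map fun x : I => -Real.log x)
      = (volume.restrict (Ioi (0 : ℝ))).withDensity fun t =>
        ENNReal.ofReal (Real.exp (-(1 * t)) * g t) := by
    intro g
    rw [Measure.map_map hlog measurable_expNegI]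
    conv_rhs => rw [← Measure.map_id (μ := (volume.restrict (Ioi (0 : ℝ))).withDensity fun t =>
        ENNReal.ofReal (Real.exp (-(1 * t)) * g t))]
    refine Measure.map_congr ((withDensity_absolutelyContinuous _ _).ae_le ?_)
    filter_upwards [ae_restrict_mem measurableSet_Ioi] with t ht
    simp [expNegI, max_eq_left (le_of_lt (mem_Ioi.1 ht))]
  have heq := congrArg (fun ν : Measure I => ν.map fun x : I => -Real.log x) hmap
  simp only [hinv] at heq
  have hae := (withDensity_eq_iff_of_sigmaFinite (hi₁ 1 one_pos).1.aemeasurable.ennreal_ofReal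
    (hi₂ 1 one_pos).1.aemeasurable.ennreal_ofReal).1 heq
  filter_upwards [hae, ae_restrict_mem measurableSet_Ioi] with t ht ht0
  rw [ENNReal.ofReal_eq_ofReal_iff (mul_nonneg (Real.exp_pos _).le (hp₁ t ht0))
    (mul_nonneg (Real.exp_pos _).le (hp₂ t ht0))] at ht
  exact mul_left_cancel₀ (Real.exp_pos _).ne' ht

/-- Equality almost everywhere gives equality at points arbitrarily close to `t` from the left;
left-continuity does the rest. -/
theorem IsPropagationFunction.unique {m : ℝ → ℝ} {w₁ w₂ : ℝ → ℝ → ℝ}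
    (h₁ : IsPropagationFunction m w₁) (h₂ : IsPropagationFunction m w₂) {t τ : ℝ} (ht : 0 ≤ t)
    (hτ : 0 ≤ τ) : w₁ t τ = w₂ t τ := by
  obtain ⟨hm₁, hz₁, hc₁, hl₁⟩ := h₁ τ hτ
  obtain ⟨hm₂, hz₂, hc₂, hl₂⟩ := h₂ τ hτ
  rcases ht.eq_or_lt with rfl | ht
  · rw [hz₁, hz₂]
  have hae := ae_eq_of_laplace_eq (g₁ := fun t => w₁ t τ) (g₂ := fun t => w₂ t τ)
    (fun t ht => hz₁ ▸ hm₁ self_mem_Ici ht.le ht.le) (fun t ht => hz₂ ▸ hm₂ self_mem_Ici ht.le ht.le)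
    (fun lam hl => (hl₁ lam hl).1) (fun lam hl => (hl₂ lam hl).1)
    (fun lam hl => (hl₁ lam hl).2.trans (hl₂ lam hl).2.symm)
  have hfreq : ∃ᶠ s in 𝓝[<] t, w₁ s τ - w₂ s τ ∈ ({0} : Set ℝ) := by
    intro hev
    obtain ⟨a, ha, hsub⟩ := (mem_nhdsLT_iff_exists_Ioo_subset' ht).1 hev
    have hlt : max a 0 < t := max_lt ha ht
    have hnull : volume (Ioo (max a 0) t) = 0 := by
      refine measure_mono_null (fun s hs => ?_) ((ae_restrict_iff' measurableSet_Ioi).1 hae)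
      have hs0 : s ∈ Ioi (0 : ℝ) := (le_max_right a 0).trans_lt hs.1
      have := hsub ⟨(le_max_left a 0).trans_lt hs.1, hs.2⟩
      exact fun hcon => this (sub_eq_zero.2 (hcon hs0))
    rw [Real.volume_Ioo, ENNReal.ofReal_eq_zero] at hnull
    linarith
  have hlim : Tendsto (fun s => w₁ s τ - w₂ s τ) (𝓝[<] t) (𝓝 (w₁ t τ - w₂ t τ)) :=
    ((hc₁ t ht).mono Iio_subset_Iic_self).sub ((hc₂ t ht).mono Iio_subset_Iic_self)
  exact sub_eq_zero.1 (isClosed_singleton.mem_of_frequently_of_tendsto hfreq hlim)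

/-! ### Existence, bounds and monotonicity of the propagation function -/

section kernel

variable {k : ℝ → ℝ}

/-- `propagation` is defined by choice; existence and uniqueness identify it with distribution
functions of explicit laws, from which its properties are read off. -/
theorem exists_propagationLaw (hk : IsCompletelyMonotone k) (hi : IsLocallyIntegrableKernel k) :
    ∃ μ : ℝ → ProbabilityMeasure I, (∀ τ, 0 ≤ τ → HasPowerTransform (μ τ : Measure I)
        fun lam => Real.exp (-(τ * laplaceExponent (fun r => 1 + k r) lam))) ∧
      ∀ t τ, 0 ≤ t → 0 ≤ τ →
        propagation (fun r => 1 + k r) t τ = logDistribution (μ τ : Measure I) t := by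
  have h : ∀ τ : ℝ, ∃ μ : ProbabilityMeasure I, 0 ≤ τ → HasPowerTransform (μ : Measure I)
      fun lam => Real.exp (-(τ * laplaceExponent (fun r => 1 + k r) lam)) := by
    intro τ
    by_cases hτ : 0 ≤ τ
    · obtain ⟨μ, hμ⟩ := isPowerTransform_exp_laplaceExponent hk hi hτ
      exact ⟨μ, fun _ => hμ⟩
    · exact ⟨⟨Measure.dirac 0, inferInstance⟩, fun h => absurd h hτ⟩
  choose μ hμ using h
  refine ⟨μ, hμ, fun t τ ht hτ => ?_⟩
  have hw : IsPropagationFunction (fun r => 1 + k r)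
      fun t τ => logDistribution (μ τ : Measure I) t :=
    isPropagationFunction_logDistribution hμ
  have hex : ∃ w, IsPropagationFunction (fun r => 1 + k r) w := ⟨_, hw⟩
  rw [propagation, dif_pos hex]
  exact hex.choose_spec.unique hw ht hτ

theorem propagation_nonneg (hk : IsCompletelyMonotone k) (hi : IsLocallyIntegrableKernel k)
    {t τ : ℝ} (ht : 0 ≤ t) (hτ : 0 ≤ τ) : 0 ≤ propagation (fun r => 1 + k r) t τ := by
  obtain ⟨μ, -, hμ⟩ := exists_propagationLaw hk hi
  exact hμ t τ ht hτ ▸ logDistribution_nonneg _ _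

theorem propagation_le_one (hk : IsCompletelyMonotone k) (hi : IsLocallyIntegrableKernel k)
    {t τ : ℝ} (ht : 0 ≤ t) (hτ : 0 ≤ τ) : propagation (fun r => 1 + k r) t τ ≤ 1 := by
  obtain ⟨μ, -, hμ⟩ := exists_propagationLaw hk hi
  exact hμ t τ ht hτ ▸ logDistribution_le_one _ _

theorem propagation_mono_time (hk : IsCompletelyMonotone k) (hi : IsLocallyIntegrableKernel k)
    {s t τ : ℝ} (hs : 0 ≤ s) (hst : s ≤ t) (hτ : 0 ≤ τ) :
    propagation (fun r => 1 + k r) s τ ≤ propagation (fun r => 1 + k r) t τ := by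
  obtain ⟨μ, -, hμ⟩ := exists_propagationLaw hk hi
  rw [hμ s τ hs hτ, hμ t τ (hs.trans hst) hτ]
  exact monotone_logDistribution _ hst

/-- The law at `τ` is that of a product `x₁ x₂` of independent variables with laws at `s` and `τ -
s`, and `x₁ x₂ ≤ x₁`. -/
theorem propagation_anti (hk : IsCompletelyMonotone k) (hi : IsLocallyIntegrableKernel k)
    {t s τ : ℝ} (ht : 0 ≤ t) (hs : 0 ≤ s) (hsτ : s ≤ τ) :
    propagation (fun r => 1 + k r) t τ ≤ propagation (fun r => 1 + k r) t s := by
  obtain ⟨μ, hF, hμ⟩ := exists_propagationLaw hk hi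
  rw [hμ t s ht hs, hμ t τ ht (hs.trans hsτ)]
  have hm : Measurable fun x : I × I => x.1 * x.2 := by fun_prop
  have hconv : (μ τ : Measure I) =
      ((μ s : Measure I).prod (μ (τ - s) : Measure I)).map fun x : I × I => x.1 * x.2 := by
    have : IsProbabilityMeasure (((μ s : Measure I).prod (μ (τ - s) : Measure I)).map
        fun x : I × I => x.1 * x.2) := Measure.isProbabilityMeasure_map hm.aemeasurable
    refine ext_of_moments fun n => ?_
    -- The transforms are known only for `λ > 0`; the zeroth moment is the total mass.
    rcases Nat.eq_zero_or_pos n with rfl | hn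
    · simp
    · have hn' : (0 : ℝ) < n := by exact_mod_cast hn
      rw [integral_map hm.aemeasurable (by fun_prop)]
      simp only [Set.Icc.coe_mul, mul_pow]
      rw [integral_prod_mul (fun x : I => (x : ℝ) ^ n) (fun x : I => (x : ℝ) ^ n)]
      simp only [← Real.rpow_natCast]
      rw [hF τ (hs.trans hsτ) n hn', hF s hs n hn', hF (τ - s) (sub_nonneg.2 hsτ) n hn',
        ← Real.exp_add]
      ring_nf
  rw [hconv, logDistribution, map_measureReal_apply hm (measurableSet_exp_lt t)]
  calc ((μ s : Measure I).prod (μ (τ - s) : Measure I)).real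
        ((fun x : I × I => x.1 * x.2) ⁻¹' {x : I | Real.exp (-t) < x})
      ≤ ((μ s : Measure I).prod (μ (τ - s) : Measure I)).real
        ({x : I | Real.exp (-t) < x} ×ˢ univ) := by
        refine measureReal_mono fun x hx => ⟨?_, mem_univ _⟩
        have hx' : Real.exp (-t) < (x.1 : ℝ) * x.2 := hx
        exact hx'.trans_le (mul_le_of_le_one_right x.1.2.1 x.2.2.2)
    _ = logDistribution (μ s : Measure I) t := by
        rw [measureReal_prod_prod, probReal_univ, mul_one, logDistribution]

end kernel

end RayleighStokes

namespace RayleighStokes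

open Filter Topology ProbabilityTheory

/-! ### The heat semigroup -/

theorem heatKernel_nonneg (d : ℕ) {τ : ℝ} (hτ : 0 < τ) (y : EuclideanSpace ℝ (Fin d)) :
    0 ≤ heatKernel d τ y := by
  unfold heatKernel
  positivity

theorem integral_heatKernel (d : ℕ) {τ : ℝ} (hτ : 0 < τ) :
    ∫ y : EuclideanSpace ℝ (Fin d), heatKernel d τ y = 1 := by
  have h := GaussianFourier.integral_rexp_neg_mul_sq_norm (V := EuclideanSpace ℝ (Fin d))
    (show 0 < 1 / (4 * τ) by positivity)
  have h4 : 0 < 4 * Real.pi * τ := by positivity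
  have e : ∀ y : EuclideanSpace ℝ (Fin d),
      -‖y‖ ^ 2 / (4 * τ) = -(1 / (4 * τ)) * ‖y‖ ^ 2 := fun y => by ring
  have e2 : Real.pi / (1 / (4 * τ)) = 4 * Real.pi * τ := by field_simp
  simp only [heatKernel, e]
  rw [integral_const_mul, h, finrank_euclideanSpace_fin, e2, ← Real.rpow_add h4, neg_div,
    neg_add_cancel, Real.rpow_zero]

/-- A non-integrable function would have the default integral `0`, not `1`. -/
theorem integrable_heatKernel (d : ℕ) {τ : ℝ} (hτ : 0 < τ) : Integrable (heatKernel d τ) :=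
  not_imp_comm.1 integral_undef (by rw [integral_heatKernel d hτ]; exact one_ne_zero)

theorem measurable_heatKernel (d : ℕ) :
    Measurable fun q : ℝ × EuclideanSpace ℝ (Fin d) => heatKernel d q.1 q.2 := by
  unfold heatKernel
  fun_prop

section heat

variable {𝕜 : Type} [RCLike 𝕜] {d : ℕ} {p : ℝ≥0∞}

theorem translate_sub (y : EuclideanSpace ℝ (Fin d)) (u v : LpSpace 𝕜 d p) :
    translate y (u - v) = translate y u - translate y v :=
  map_sub (Lp.compMeasurePreserving _ _) u v

theorem norm_translate (y : EuclideanSpace ℝ (Fin d)) (v : LpSpace 𝕜 d p) :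
    ‖translate y v‖ = ‖v‖ :=
  Lp.norm_compMeasurePreserving v _

variable [Fact (1 ≤ p)]

theorem continuous_translate (hp : p ≠ ∞) (v : LpSpace 𝕜 d p) :
    Continuous fun y : EuclideanSpace ℝ (Fin d) => translate y v := by
  have hc : Continuous fun q : EuclideanSpace ℝ (Fin d) × EuclideanSpace ℝ (Fin d) =>
      q.2 - q.1 := by fun_prop
  exact Continuous.compMeasurePreservingLp
    (g := fun y => (⟨fun x => x - y, by fun_prop⟩ : C(EuclideanSpace ℝ (Fin d), _)))
    continuous_const (ContinuousMap.continuous_of_continuous_uncurry _ hc) _ hp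

theorem integrable_heatKernel_smul (hp : p ≠ ∞) {τ : ℝ} (hτ : 0 < τ) (v : LpSpace 𝕜 d p) :
    Integrable fun y : EuclideanSpace ℝ (Fin d) => heatKernel d τ y • translate y v := by
  refine ((integrable_heatKernel d hτ).mul_const ‖v‖).mono
    ((integrable_heatKernel d hτ).1.smul (continuous_translate hp v).aestronglyMeasurable)
    (Eventually.of_forall fun y => ?_)
  rw [norm_smul, norm_translate, norm_mul, norm_norm]

theorem heatSemigroup_sub (hp : p ≠ ∞) (τ : ℝ) (u v : LpSpace 𝕜 d p) :
    heatSemigroup τ (u - v) = heatSemigroup τ u - heatSemigroup τ v := by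
  unfold heatSemigroup
  split_ifs with h
  · rfl
  · rw [← integral_sub (integrable_heatKernel_smul hp (not_le.1 h) u)
      (integrable_heatKernel_smul hp (not_le.1 h) v)]
    simp only [translate_sub, smul_sub]

theorem norm_heatSemigroup_le (τ : ℝ) (v : LpSpace 𝕜 d p) : ‖heatSemigroup τ v‖ ≤ ‖v‖ := by
  unfold heatSemigroup
  split_ifs with h
  · rfl
  · have hτ := not_le.1 h
    refine (norm_integral_le_integral_norm _).trans_eq ?_
    simp only [norm_smul, norm_translate]
    rw [integral_mul_const]
    simp only [Real.norm_of_nonneg (heatKernel_nonneg d hτ _)]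
    rw [integral_heatKernel d hτ, one_mul]

theorem stronglyMeasurable_heatSemigroup (hp : p ≠ ∞) (v : LpSpace 𝕜 d p) :
    StronglyMeasurable fun τ : ℝ => heatSemigroup τ v := by
  refine StronglyMeasurable.ite measurableSet_Iic stronglyMeasurable_const ?_
  refine StronglyMeasurable.integral_prod_right
    (f := fun (τ : ℝ) (y : EuclideanSpace ℝ (Fin d)) => heatKernel d τ y • translate y v) ?_
  exact (measurable_heatKernel d).stronglyMeasurable.smul
    ((continuous_translate hp v).stronglyMeasurable.comp_measurable measurable_snd)

end heat

/-! ### The Stieltjes measures and the solution operators -/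

section kernel

variable {k : ℝ → ℝ}

theorem negPropagation_mem (hk : IsCompletelyMonotone k) (hi : IsLocallyIntegrableKernel k)
    {t : ℝ} (ht : 0 ≤ t) (τ : ℝ) : negPropagation (fun r => 1 + k r) t τ ∈ Icc (-1 : ℝ) 0 := by
  unfold negPropagation
  split_ifs with h
  · simp
  · have h1 := propagation_nonneg hk hi ht (not_lt.1 h)
    have h2 := propagation_le_one hk hi ht (not_lt.1 h)
    constructor <;> linarith

theorem monotone_negPropagation (hk : IsCompletelyMonotone k) (hi : IsLocallyIntegrableKernel k)
    {t : ℝ} (ht : 0 ≤ t) : Monotone (negPropagation (fun r => 1 + k r) t) := by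
  intro s τ hsτ
  by_cases hs : s < 0
  · rw [negPropagation, if_pos hs]
    exact (negPropagation_mem hk hi ht τ).1
  · have hτ : ¬ τ < 0 := not_lt.2 ((not_lt.1 hs).trans hsτ)
    rw [negPropagation, negPropagation, if_neg hs, if_neg hτ]
    exact neg_le_neg (propagation_anti hk hi ht (not_lt.1 hs) hsτ)

theorem negPropagation_anti_time (hk : IsCompletelyMonotone k) (hi : IsLocallyIntegrableKernel k)
    {s t : ℝ} (hs : 0 ≤ s) (hst : s ≤ t) (τ : ℝ) :
    negPropagation (fun r => 1 + k r) t τ ≤ negPropagation (fun r => 1 + k r) s τ := by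
  unfold negPropagation
  split_ifs with h
  · rfl
  · exact neg_le_neg (propagation_mono_time hk hi hs hst (not_lt.1 h))

theorem propagationMeasure_eq (hk : IsCompletelyMonotone k) (hi : IsLocallyIntegrableKernel k)
    {t : ℝ} (ht : 0 ≤ t) : propagationMeasure (fun r => 1 + k r) t =
      (monotone_negPropagation hk hi ht).stieltjesFunction.measure := by
  rw [propagationMeasure, dif_pos (monotone_negPropagation hk hi ht)]

theorem stieltjes_mem (hk : IsCompletelyMonotone k) (hi : IsLocallyIntegrableKernel k)
    {t : ℝ} (ht : 0 ≤ t) (τ : ℝ) :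
    (monotone_negPropagation hk hi ht).stieltjesFunction τ ∈ Icc (-1 : ℝ) 0 := by
  have hm := monotone_negPropagation hk hi ht
  rw [hm.stieltjesFunction_eq]
  exact ⟨(negPropagation_mem hk hi ht τ).1.trans (hm.le_rightLim le_rfl),
    (hm.rightLim_le (lt_add_one τ)).trans (negPropagation_mem hk hi ht _).2⟩

theorem tendsto_stieltjes_atBot (hk : IsCompletelyMonotone k) (hi : IsLocallyIntegrableKernel k)
    {t : ℝ} (ht : 0 ≤ t) :
    Tendsto (monotone_negPropagation hk hi ht).stieltjesFunction atBot (𝓝 (-1)) := by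
  have hm := monotone_negPropagation hk hi ht
  refine tendsto_const_nhds.congr' ?_
  filter_upwards [eventually_lt_atBot (-1 : ℝ)] with τ hτ
  refine le_antisymm (stieltjes_mem hk hi ht τ).1 ?_
  rw [hm.stieltjesFunction_eq]
  refine (hm.rightLim_le (show τ < τ / 2 by linarith)).trans ?_
  rw [negPropagation, if_pos (by linarith)]

/-- The Stieltjes function starts at `-1` and stays below `0`. Its limit at `+∞` is not needed,
since mass at most `1` already makes `S(t)` nonexpansive. -/
theorem propagationMeasure_univ_le (hk : IsCompletelyMonotone k)
    (hi : IsLocallyIntegrableKernel k) {t : ℝ} (ht : 0 ≤ t) :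
    propagationMeasure (fun r => 1 + k r) t univ ≤ 1 := by
  rw [propagationMeasure_eq hk hi ht]
  set F := (monotone_negPropagation hk hi ht).stieltjesFunction with hF
  have hbdd : BddAbove (range F) := ⟨0, by
    rintro _ ⟨τ, rfl⟩
    exact (stieltjes_mem hk hi ht τ).2⟩
  rw [F.measure_univ (tendsto_stieltjes_atBot hk hi ht) (tendsto_atTop_ciSup F.mono hbdd)]
  refine ENNReal.ofReal_le_one.2 ?_
  have : ⨆ τ, F τ ≤ 0 := ciSup_le fun τ => (stieltjes_mem hk hi ht τ).2
  linarith

theorem isFiniteMeasure_propagationMeasure (hk : IsCompletelyMonotone k)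
    (hi : IsLocallyIntegrableKernel k) {t : ℝ} (ht : 0 ≤ t) :
    IsFiniteMeasure (propagationMeasure (fun r => 1 + k r) t) :=
  ⟨(propagationMeasure_univ_le hk hi ht).trans_lt ENNReal.one_lt_top⟩

/-- As `w` increases in `t`, the mass of each half-line `Iic x` is antitone in `t`, hence
measurable, and half-lines form a generating π-system. The truncation `max t 0` gives a kernel on
all of `ℝ`. -/
theorem measurable_propagationMeasure (hk : IsCompletelyMonotone k)
    (hi : IsLocallyIntegrableKernel k) :
    Measurable fun t : ℝ => propagationMeasure (fun r => 1 + k r) (max t 0) := by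
  have ht : ∀ t : ℝ, 0 ≤ max t 0 := fun t => le_max_right t 0
  have := fun t => isFiniteMeasure_propagationMeasure hk hi (ht t)
  have hIic : ∀ x : ℝ, Measurable fun t : ℝ =>
      propagationMeasure (fun r => 1 + k r) (max t 0) (Iic x) := by
    intro x
    have hanti : Antitone fun t : ℝ =>
        propagationMeasure (fun r => 1 + k r) (max t 0) (Iic x) := by
      intro s t hst
      simp only [propagationMeasure_eq hk hi (ht _)]
      rw [StieltjesFunction.measure_Iic _ (tendsto_stieltjes_atBot hk hi (ht s)),
        StieltjesFunction.measure_Iic _ (tendsto_stieltjes_atBot hk hi (ht t))]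
      refine ENNReal.ofReal_le_ofReal (sub_le_sub_right ?_ _)
      exact le_of_tendsto_of_tendsto' ((monotone_negPropagation hk hi (ht t)).tendsto_rightLim x)
        ((monotone_negPropagation hk hi (ht s)).tendsto_rightLim x) fun τ =>
          negPropagation_anti_time hk hi (ht s) (max_le_max_right 0 hst) τ
    exact hanti.measurable
  refine Measurable.measure_of_isPiSystem (borel_eq_generateFrom_Iic ℝ ▸ BorelSpace.measurable_eq)
    isPiSystem_Iic ?_ ?_
  · rintro _ ⟨x, rfl⟩
    exact hIic x
  · have hU : ∀ t : ℝ, propagationMeasure (fun r => 1 + k r) (max t 0) univ =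
        ⨆ n : ℕ, propagationMeasure (fun r => 1 + k r) (max t 0) (Iic (n : ℝ)) := by
      intro t
      rw [← Monotone.measure_iUnion fun m n hmn => Iic_subset_Iic.2 (by exact_mod_cast hmn)]
      congr 1
      exact (eq_univ_of_forall fun x => mem_iUnion.2 (exists_nat_ge x)).symm
    simp only [hU]
    exact Measurable.iSup fun n => hIic n

variable {𝕜 : Type} [RCLike 𝕜] {d : ℕ} {p : ℝ≥0∞} [Fact (1 ≤ p)]

theorem integrable_heatSemigroup (hp : p ≠ ∞) (μ : Measure ℝ) [IsFiniteMeasure μ]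
    (v : LpSpace 𝕜 d p) : Integrable (fun τ => heatSemigroup τ v) μ :=
  (integrable_const ‖v‖).mono (stronglyMeasurable_heatSemigroup hp v).aestronglyMeasurable
    (Eventually.of_forall fun τ => by simpa using norm_heatSemigroup_le τ v)

theorem norm_solutionOperator_sub_le (hp : p ≠ ∞) (hk : IsCompletelyMonotone k)
    (hi : IsLocallyIntegrableKernel k) {t : ℝ} (ht : 0 ≤ t) (u v : LpSpace 𝕜 d p) :
    ‖solutionOperator k t u - solutionOperator k t v‖ ≤ ‖u - v‖ := by
  have := isFiniteMeasure_propagationMeasure hk hi ht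
  unfold solutionOperator
  rw [← integral_sub (integrable_heatSemigroup hp _ u) (integrable_heatSemigroup hp _ v)]
  simp only [← heatSemigroup_sub hp]
  refine (norm_integral_le_of_norm_le_const (Eventually.of_forall fun τ =>
    norm_heatSemigroup_le τ (u - v))).trans ?_
  refine mul_le_of_le_one_right (norm_nonneg _) ?_
  exact ENNReal.toReal_le_of_le_ofReal zero_le_one
    (by simpa using propagationMeasure_univ_le hk hi ht)

theorem solutionOperator_zero_right (t : ℝ) : solutionOperator k t (0 : LpSpace 𝕜 d p) = 0 := by
  have h : ∀ τ : ℝ, heatSemigroup τ (0 : LpSpace 𝕜 d p) = 0 := fun τ =>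
    norm_le_zero_iff.1 ((norm_heatSemigroup_le τ 0).trans_eq norm_zero)
  simp only [solutionOperator, h, integral_zero]

theorem stronglyMeasurable_solutionOperator (hp : p ≠ ∞) (hk : IsCompletelyMonotone k)
    (hi : IsLocallyIntegrableKernel k) (v : LpSpace 𝕜 d p) :
    StronglyMeasurable fun t : ℝ => solutionOperator k (max t 0) v := by
  let κ : Kernel ℝ ℝ := ⟨fun t => propagationMeasure (fun r => 1 + k r) (max t 0),
    measurable_propagationMeasure hk hi⟩
  exact (stronglyMeasurable_heatSemigroup hp v).integral_kernel (κ := κ)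

end kernel

end RayleighStokes

namespace RayleighStokes

open Filter Topology

/-! ### Volterra equations with a strongly measurable family of Lipschitz maps -/

/-- `A t` is a strongly measurable family of Lipschitz maps with constant `L`, fixing `0`. -/
structure IsLipschitzFamily {X : Type*} [NormedAddCommGroup X] (A : ℝ → X → X) (L : ℝ) : Prop where
  pos : 0 < L
  map_zero : ∀ t, A t 0 = 0
  lipschitz : ∀ t u v, ‖A t u - A t v‖ ≤ L * ‖u - v‖
  measurable : ∀ x, StronglyMeasurable fun t => A t x

section volterra

variable {X : Type*} [NormedAddCommGroup X]

/-- The translate `r ↦ u (s + r)` of a path. -/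
def shiftPath (s : ℝ≥0) (u : C(ℝ≥0, X)) : C(ℝ≥0, X) := ⟨fun r => u (s + r), by fun_prop⟩

variable {A : ℝ → X → X} {L : ℝ}

theorem IsLipschitzFamily.norm_le (hA : IsLipschitzFamily A L) (t : ℝ) (x : X) :
    ‖A t x‖ ≤ L * ‖x‖ := by
  simpa [hA.map_zero t] using hA.lipschitz t x 0

theorem IsLipschitzFamily.continuous (hA : IsLipschitzFamily A L) (t : ℝ) :
    Continuous (A t) :=
  (LipschitzWith.of_dist_le_mul (K := L.toNNReal) fun u v => by
    rw [dist_eq_norm, dist_eq_norm, Real.coe_toNNReal L hA.pos.le]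
    exact hA.lipschitz t u v).continuous

theorem continuous_path (u : C(ℝ≥0, X)) : Continuous fun τ : ℝ => u τ.toNNReal :=
  u.continuous.comp continuous_real_toNNReal

/-- Carathéodory's criterion: `A t (u r)` is continuous in `r` and measurable in `t`, hence jointly
measurable. -/
theorem IsLipschitzFamily.stronglyMeasurable_comp (hA : IsLipschitzFamily A L)
    (u : C(ℝ≥0, X)) {a b : ℝ → ℝ} (ha : Measurable a) (hb : Measurable b) :
    StronglyMeasurable fun τ => A (a τ) (u (b τ).toNNReal) := by
  have h : StronglyMeasurable (Function.uncurry fun (r : ℝ) (t : ℝ) => A t (u r.toNNReal)) :=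
    stronglyMeasurable_uncurry_of_continuous_of_stronglyMeasurable
      (fun t => (hA.continuous t).comp (continuous_path u)) fun r => hA.measurable _
  exact h.comp_measurable (hb.prodMk ha)

theorem IsLipschitzFamily.intervalIntegrable (hA : IsLipschitzFamily A L) (u : C(ℝ≥0, X))
    (r a b : ℝ) : IntervalIntegrable (fun τ => A (r - τ) (u τ.toNNReal)) volume a b := by
  have h : IntervalIntegrable (fun τ : ℝ => L * ‖u τ.toNNReal‖) volume a b :=
    (continuous_const.mul (continuous_path u).norm).intervalIntegrable a b
  refine h.mono_fun (hA.stronglyMeasurable_comp u (by fun_prop) measurable_id).aestronglyMeasurable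
    (Eventually.of_forall fun τ => ?_)
  exact (hA.norm_le _ _).trans (le_abs_self _)

variable [NormedSpace ℝ X]

theorem IsLipschitzFamily.norm_integral_sub_le (hA : IsLipschitzFamily A L) (u v : C(ℝ≥0, X))
    (r : ℝ) {t : ℝ} (ht : 0 ≤ t) :
    ‖(∫ τ in (0 : ℝ)..t, A (r - τ) (u τ.toNNReal)) - ∫ τ in (0 : ℝ)..t, A (r - τ) (v τ.toNNReal)‖
      ≤ L * ∫ τ in (0 : ℝ)..t, ‖u τ.toNNReal - v τ.toNNReal‖ := by
  rw [← intervalIntegral.integral_sub (hA.intervalIntegrable u r 0 t)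
    (hA.intervalIntegrable v r 0 t), ← intervalIntegral.integral_const_mul]
  refine intervalIntegral.norm_integral_le_of_norm_le ht
    (Eventually.of_forall fun τ _ => hA.lipschitz _ _ _) ?_
  exact (continuous_const.mul ((continuous_path u).sub (continuous_path v)).norm).intervalIntegrable
    0 t

/-- In this form the parameter enters only through the endpoints and the continuous path, never
through the time argument of `A`, so dominated convergence works although `A` is merely measurable
in time. -/
theorem IsLipschitzFamily.continuous_integral (hA : IsLipschitzFamily A L) (u : C(ℝ≥0, X))
    {a b : ℝ≥0 → ℝ} (ha : Continuous a) (hb : Continuous b) (hab : ∀ x, a x ≤ b x) :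
    Continuous fun x => ∫ s in a x..b x, A s (u (b x - s).toNNReal) := by
  refine continuous_iff_continuousAt.2 fun x₀ => ?_
  simp only [fun x => intervalIntegral.integral_of_le (hab x) (μ := volume)
    (f := fun s => A s (u (b x - s).toNNReal)), ← integral_indicator measurableSet_Ioc]
  have hcpt : IsCompact ((fun τ : ℝ => ‖u τ.toNNReal‖) ''
      Icc 0 (b x₀ + 1 - (a x₀ - 1))) :=
    isCompact_Icc.image (continuous_path u).norm
  obtain ⟨M, hM⟩ := hcpt.bddAbove
  refine tendsto_integral_filter_of_dominated_convergence
    ((Ioc (a x₀ - 1) (b x₀ + 1)).indicator fun _ => L * M) ?_ ?_ ?_ ?_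
  · exact Eventually.of_forall fun x => ((hA.stronglyMeasurable_comp u measurable_id
      (by fun_prop)).indicator measurableSet_Ioc).aestronglyMeasurable
  · filter_upwards [ha.continuousAt.eventually_const_lt (sub_one_lt (a x₀)),
      hb.continuousAt.eventually_lt_const (lt_add_one (b x₀))] with x h1 h2
    refine Eventually.of_forall fun s => ?_
    by_cases hs : s ∈ Ioc (a x) (b x)
    · rw [indicator_of_mem hs, indicator_of_mem
        (show s ∈ Ioc (a x₀ - 1) (b x₀ + 1) from ⟨h1.trans hs.1, hs.2.trans h2.le⟩)]
      refine (hA.norm_le _ _).trans (mul_le_mul_of_nonneg_left (hM ⟨b x - s, ⟨?_, ?_⟩, rfl⟩)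
        hA.pos.le)
      · linarith [hs.2]
      · linarith [hs.1]
    · rw [indicator_of_notMem hs, norm_zero]
      refine indicator_nonneg (fun _ _ => mul_nonneg hA.pos.le ?_) s
      refine (norm_nonneg _).trans (hM ⟨0, ⟨le_rfl, ?_⟩, rfl⟩)
      linarith [hab x₀]
  · exact (integrable_indicator_iff measurableSet_Ioc).2 (integrableOn_const (by simp))
  · have hne : ∀ c : ℝ, ∀ᵐ s : ℝ, s ≠ c := fun c => by simp [ae_iff, measure_singleton]
    filter_upwards [hne (a x₀), hne (b x₀)] with s hsa hsb
    by_cases hs : s ∈ Ioc (a x₀) (b x₀)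
    · have h1 : Tendsto (fun x => A s (u (b x - s).toNNReal)) (𝓝 x₀)
          (𝓝 (A s (u (b x₀ - s).toNNReal))) :=
        (((hA.continuous s).comp (continuous_path u)).comp (hb.sub continuous_const)).tendsto x₀
      rw [indicator_of_mem hs]
      refine h1.congr' ?_
      filter_upwards [ha.continuousAt.eventually_lt_const hs.1,
        hb.continuousAt.eventually_const_lt (lt_of_le_of_ne hs.2 hsb)] with x h2 h3
      rw [indicator_of_mem (show s ∈ Ioc (a x) (b x) from ⟨h2, h3.le⟩)]
    · rw [indicator_of_notMem hs]
      refine tendsto_const_nhds.congr' ?_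
      rcases lt_or_ge (a x₀) s with h | h
      · have h' : b x₀ < s := lt_of_not_ge fun hle => hs ⟨h, hle⟩
        filter_upwards [hb.continuousAt.eventually_lt_const h'] with x hx
        rw [indicator_of_notMem fun hmem => absurd hmem.2 (not_le.2 hx)]
      · have h' : s < a x₀ := lt_of_le_of_ne h hsa
        filter_upwards [ha.continuousAt.eventually_const_lt h'] with x hx
        rw [indicator_of_notMem fun hmem => absurd hmem.1 (not_lt.2 hx.le)]

theorem integral_duhamel_eq (A : ℝ → X → X) (u : C(ℝ≥0, X)) (t θ : ℝ) :
    ∫ τ in (0 : ℝ)..t, A (t + θ - τ) (u τ.toNNReal) =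
      ∫ s in θ..t + θ, A s (u (t + θ - s).toNNReal) := by
  have h := intervalIntegral.integral_comp_sub_left (a := 0) (b := t)
    (fun s => A s (u (t + θ - s).toNNReal)) (t + θ)
  simp only [sub_sub_cancel, sub_zero, add_sub_cancel_left] at h
  exact h

/-- The Volterra operator `u ↦ ∫_0^t A (t - τ) (u τ) dτ`. -/
noncomputable def volterra (hA : IsLipschitzFamily A L) (u : C(ℝ≥0, X)) : C(ℝ≥0, X) :=
  ⟨fun t => ∫ τ in (0 : ℝ)..t, A (t - τ) (u τ.toNNReal), by
    have h := hA.continuous_integral u (a := fun _ => 0) (b := fun t => (t : ℝ)) (by fun_prop)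
      (by fun_prop) fun t => t.coe_nonneg
    refine h.congr fun t => ?_
    simpa using (integral_duhamel_eq A u t 0).symm⟩

/-- The path `θ ↦ ∫_0^t A (t + θ - τ) (u τ) dτ`. -/
noncomputable def volterraTail (hA : IsLipschitzFamily A L) (u : C(ℝ≥0, X)) (t : ℝ≥0) :
    C(ℝ≥0, X) :=
  ⟨fun θ => ∫ τ in (0 : ℝ)..t, A ((t + θ : ℝ≥0) - τ) (u τ.toNNReal), by
    have h := hA.continuous_integral u (a := fun θ => (θ : ℝ)) (b := fun θ => (t : ℝ) + θ)
      (by fun_prop) (by fun_prop) fun θ => le_add_of_nonneg_left t.coe_nonneg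
    refine h.congr fun θ => ?_
    simpa using (integral_duhamel_eq A u t θ).symm⟩

/-- The rate `2L` is chosen so that `L ∫_0^t e^{2Lτ} dτ ≤ e^{2Lt} / 2`: in the weighted sup norm, `L
∫` has norm at most `1/2`. -/
theorem mul_integral_le_of_le_exp (hL : 0 < L) {g : ℝ → ℝ} (hg : Continuous g) {C t : ℝ}
    (ht : 0 ≤ t) (hC : 0 ≤ C) (h : ∀ τ, 0 ≤ τ → τ ≤ t → g τ ≤ C * Real.exp (2 * L * τ)) :
    L * ∫ τ in (0 : ℝ)..t, g τ ≤ C / 2 * Real.exp (2 * L * t) := by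
  have hL2 : 2 * L ≠ 0 := by positivity
  have h1 : ∫ τ in (0 : ℝ)..t, g τ ≤ ∫ τ in (0 : ℝ)..t, C * Real.exp (2 * L * τ) :=
    intervalIntegral.integral_mono_on ht (hg.intervalIntegrable _ _)
      ((by fun_prop : Continuous fun τ => C * Real.exp (2 * L * τ)).intervalIntegrable _ _)
      fun τ hτ => h τ hτ.1 hτ.2
  have h2 : ∫ τ in (0 : ℝ)..t, C * Real.exp (2 * L * τ)
      = C * ((Real.exp (2 * L * t) - 1) / (2 * L)) := by
    rw [intervalIntegral.integral_const_mul,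
      intervalIntegral.integral_comp_mul_left (fun x => Real.exp x) hL2, integral_exp, smul_eq_mul,
      mul_zero, Real.exp_zero, inv_mul_eq_div]
  calc L * ∫ τ in (0 : ℝ)..t, g τ ≤ L * (C * ((Real.exp (2 * L * t) - 1) / (2 * L))) :=
        mul_le_mul_of_nonneg_left (h1.trans_eq h2) hL.le
    _ = C / 2 * Real.exp (2 * L * t) - C / 2 := by field_simp
    _ ≤ C / 2 * Real.exp (2 * L * t) := by linarith

/-- A Gronwall inequality. -/
theorem le_exp_of_le_integral (hL : 0 < L) {δ : ℝ≥0 → ℝ} (hδ : Continuous δ) {C : ℝ} (hC : 0 ≤ C)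
    {T : ℝ≥0} (h : ∀ t ≤ T, δ t ≤ C + L * ∫ τ in (0 : ℝ)..t, δ τ.toNNReal) {t : ℝ≥0} (ht : t ≤ T) :
    δ t ≤ 2 * C * Real.exp (2 * L * t) := by
  have hcont : Continuous fun t : ℝ≥0 => Real.exp (-(2 * L * t)) * δ t := by fun_prop
  obtain ⟨t₀, ht₀, hmax⟩ := isCompact_Icc.exists_isMaxOn (nonempty_Icc.2 (zero_le (a := T)))
    hcont.continuousOn
  set D := max (Real.exp (-(2 * L * t₀)) * δ t₀) 0 with hD
  have hle : ∀ t ≤ T, δ t ≤ D * Real.exp (2 * L * t) := by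
    intro t ht
    have h1 : Real.exp (-(2 * L * t)) * δ t ≤ D :=
      (hmax (show t ∈ Icc 0 T from ⟨zero_le, ht⟩)).trans (le_max_left _ _)
    have h2 := mul_le_mul_of_nonneg_right h1 (Real.exp_pos (2 * L * t)).le
    rwa [mul_right_comm, ← Real.exp_add, neg_add_cancel, Real.exp_zero, one_mul] at h2
  have hint := mul_integral_le_of_le_exp hL (hδ.comp continuous_real_toNNReal) t₀.coe_nonneg
    (le_max_right _ _ : (0 : ℝ) ≤ D) (fun τ h0 h1 => by
      have := hle τ.toNNReal ((Real.toNNReal_le_iff_le_coe.2 h1).trans ht₀.2)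
      rwa [Real.coe_toNNReal τ h0] at this)
  have h3 := (h t₀ ht₀.2).trans (add_le_add_right hint C)
  -- The inequality at the maximum point `t₀` of the weighted function bounds `D` by `C + D / 2`,
  -- whence `D ≤ 2C`.
  have h4 : D ≤ C + D / 2 := by
    refine max_le ?_ (by positivity)
    have h5 := mul_le_mul_of_nonneg_left h3 (Real.exp_pos (-(2 * L * t₀))).le
    have h6 : Real.exp (-(2 * L * t₀)) * (C + D / 2 * Real.exp (2 * L * t₀))
        = Real.exp (-(2 * L * t₀)) * C + D / 2 := by
      rw [mul_add, mul_left_comm, ← Real.exp_add, neg_add_cancel, Real.exp_zero, mul_one]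
    have h7 : Real.exp (-(2 * L * t₀)) * C ≤ C := mul_le_of_le_one_left hC
      (Real.exp_le_one_iff.2 (neg_nonpos.2 (by positivity)))
    have h5' := h5.trans_eq h6
    linarith
  exact (hle t ht).trans (mul_le_mul_of_nonneg_right (by linarith) (Real.exp_pos _).le)

/-- `u = φ + ∫_0^t A (t - τ) (u τ) dτ`. -/
def IsVolterraSolution (A : ℝ → X → X) (φ u : C(ℝ≥0, X)) : Prop :=
  ∀ t : ℝ≥0, u t = φ t + ∫ τ in (0 : ℝ)..t, A (t - τ) (u τ.toNNReal)

theorem IsVolterraSolution.norm_sub_le (hA : IsLipschitzFamily A L) {φ ψ u v : C(ℝ≥0, X)}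
    (hu : IsVolterraSolution A φ u) (hv : IsVolterraSolution A ψ v) {C : ℝ} {T : ℝ≥0}
    (h : ∀ t ≤ T, ‖φ t - ψ t‖ ≤ C) {t : ℝ≥0} (ht : t ≤ T) :
    ‖u t - v t‖ ≤ 2 * C * Real.exp (2 * L * t) := by
  refine le_exp_of_le_integral hA.pos (δ := fun t => ‖u t - v t‖) (by fun_prop)
    ((norm_nonneg _).trans (h 0 zero_le)) (fun s hs => ?_) ht
  rw [hu s, hv s, add_sub_add_comm]
  exact (norm_add_le _ _).trans (add_le_add (h s hs) (hA.norm_integral_sub_le u v s s.coe_nonneg))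

theorem IsVolterraSolution.unique (hA : IsLipschitzFamily A L) {φ u v : C(ℝ≥0, X)}
    (hu : IsVolterraSolution A φ u) (hv : IsVolterraSolution A φ v) : u = v := by
  ext t
  have := hu.norm_sub_le hA hv (C := 0) (T := t) (fun s _ => by simp) le_rfl
  rw [mul_zero, zero_mul] at this
  exact sub_eq_zero.1 (norm_le_zero_iff.1 this)

/-- The Picard iterates. -/
noncomputable def picard (hA : IsLipschitzFamily A L) (φ : C(ℝ≥0, X)) : ℕ → C(ℝ≥0, X)
  | 0 => φ
  | n + 1 => φ + volterra hA (picard hA φ n)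

theorem norm_picard_sub_le (hA : IsLipschitzFamily A L) (φ : C(ℝ≥0, X)) {T : ℝ≥0} {M : ℝ}
    (hM : ∀ t ≤ T, ‖volterra hA φ t‖ ≤ M) (n : ℕ) {t : ℝ≥0} (ht : t ≤ T) :
    ‖picard hA φ n t - picard hA φ (n + 1) t‖ ≤ M / 2 ^ n * Real.exp (2 * L * t) := by
  have hM0 : 0 ≤ M := (norm_nonneg _).trans (hM 0 zero_le)
  induction n generalizing t with
  | zero =>
    have h1 : picard hA φ 0 t - picard hA φ (0 + 1) t = -volterra hA φ t := by
      simp [picard]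
    rw [h1, norm_neg, pow_zero, div_one]
    refine (hM t ht).trans (le_mul_of_one_le_right hM0 (Real.one_le_exp ?_))
    have := hA.pos
    positivity
  | succ n ih =>
    have h1 : picard hA φ (n + 1) t - picard hA φ (n + 1 + 1) t =
        volterra hA (picard hA φ n) t - volterra hA (picard hA φ (n + 1)) t := by
      simp [picard]
    rw [h1]
    refine (hA.norm_integral_sub_le _ _ t t.coe_nonneg).trans ?_
    have h2 := mul_integral_le_of_le_exp hA.pos
      (((continuous_path (picard hA φ n)).sub (continuous_path (picard hA φ (n + 1)))).norm) t.coe_nonneg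
      (show 0 ≤ M / 2 ^ n by positivity) (fun τ h0 hτ => by
        have := ih (t := τ.toNNReal) ((Real.toNNReal_le_iff_le_coe.2 hτ).trans ht)
        rwa [Real.coe_toNNReal τ h0] at this)
    rwa [div_div, ← pow_succ] at h2

/-- Successive Picard iterates differ by a geometric sequence, uniformly on each `[0, T]`; the
locally uniform limit is continuous and the equation passes to the limit. -/
theorem exists_isVolterraSolution [CompleteSpace X] (hA : IsLipschitzFamily A L)
    (φ : C(ℝ≥0, X)) : ∃ u, IsVolterraSolution A φ u := by
  have hbd : ∀ T : ℝ≥0, ∃ C : ℝ, ∀ t ≤ T, ∀ n,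
      dist (picard hA φ n t) (picard hA φ (n + 1) t) ≤ C / 2 / 2 ^ n := by
    intro T
    obtain ⟨M, hM⟩ := (isCompact_Icc (a := (0 : ℝ≥0)) (b := T)).exists_bound_of_continuousOn
      (volterra hA φ).continuous.continuousOn
    have hM' : ∀ t ≤ T, ‖volterra hA φ t‖ ≤ M := fun t ht => hM t ⟨zero_le, ht⟩
    have hM0 : 0 ≤ M := (norm_nonneg _).trans (hM' 0 zero_le)
    refine ⟨2 * (M * Real.exp (2 * L * T)), fun t ht n => ?_⟩
    rw [dist_eq_norm]
    refine (norm_picard_sub_le hA φ hM' n ht).trans ?_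
    have : Real.exp (2 * L * t) ≤ Real.exp (2 * L * T) := by
      have h1 : (t : ℝ) ≤ T := ht
      have := hA.pos
      gcongr
    calc M / 2 ^ n * Real.exp (2 * L * t) ≤ M / 2 ^ n * Real.exp (2 * L * T) := by gcongr
      _ = 2 * (M * Real.exp (2 * L * T)) / 2 / 2 ^ n := by ring
  choose C hC using hbd
  have hlim : ∀ t : ℝ≥0, ∃ x, Tendsto (fun n => picard hA φ n t) atTop (𝓝 x) := fun t =>
    cauchySeq_tendsto_of_complete (cauchySeq_of_le_geometric_two (C := C t) (hC t t le_rfl))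
  choose U hU using hlim
  have hdist : ∀ T : ℝ≥0, ∀ t ≤ T, ∀ n, dist (picard hA φ n t) (U t) ≤ C T / 2 ^ n :=
    fun T t ht n => dist_le_of_le_geometric_two_of_tendsto (hC T t ht) (hU t) n
  have hgeom : ∀ T : ℝ≥0, Tendsto (fun n : ℕ => C T / 2 ^ n) atTop (𝓝 0) := by
    intro T
    have := (tendsto_pow_atTop_nhds_zero_of_lt_one (r := (1 / 2 : ℝ)) (by norm_num)
      (by norm_num)).const_mul (C T)
    rw [mul_zero] at this
    exact this.congr fun n => by rw [one_div, inv_pow, div_eq_mul_inv]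
  have hcont : Continuous U := by
    have hunif : TendstoLocallyUniformly (fun n t => picard hA φ n t) U atTop := by
      refine Metric.tendstoLocallyUniformly_iff.2 fun ε hε x =>
        ⟨Iic (x + 1), Iic_mem_nhds (lt_add_one x), ?_⟩
      filter_upwards [(hgeom (x + 1)).eventually_lt_const hε] with n hn t ht
      rw [dist_comm]
      exact (hdist (x + 1) t ht n).trans_lt hn
    exact hunif.continuous (Frequently.of_forall fun n => (picard hA φ n).continuous)
  refine ⟨⟨U, hcont⟩, fun t => ?_⟩
  have h1 : Tendsto (fun n => picard hA φ (n + 1) t) atTop (𝓝 (U t)) :=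
    (hU t).comp (tendsto_add_atTop_nat 1)
  have h2 : Tendsto (fun n => volterra hA (picard hA φ n) t) atTop
      (𝓝 (volterra hA ⟨U, hcont⟩ t)) := by
    rw [tendsto_iff_norm_sub_tendsto_zero]
    have h3 := ((hgeom t).mul_const (t : ℝ)).const_mul L
    rw [zero_mul, mul_zero] at h3
    refine squeeze_zero (fun n => norm_nonneg _) (fun n => ?_) h3
    refine (hA.norm_integral_sub_le _ _ t t.coe_nonneg).trans (mul_le_mul_of_nonneg_left ?_ hA.pos.le)
    have h4 := intervalIntegral.norm_integral_le_of_norm_le_const (a := (0 : ℝ)) (b := t)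
      (f := fun τ : ℝ => ‖picard hA φ n τ.toNNReal - U τ.toNNReal‖) (C := C t / 2 ^ n)
      (fun τ hτ => by
        rw [uIoc_of_le t.coe_nonneg] at hτ
        rw [norm_norm, ← dist_eq_norm]
        exact hdist t _ (Real.toNNReal_le_iff_le_coe.2 hτ.2) n)
    rw [sub_zero, abs_of_nonneg t.coe_nonneg] at h4
    exact (Real.le_norm_self _).trans h4
  exact tendsto_nhds_unique h1 (h2.const_add (φ t))

/-- Splitting at `s` separates the past, absorbed into the new datum, from the integral along the
restarted path. The case `θ = 0` restarts the equation; general `θ` gives the cocycle identity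
`evolve_add`. -/
theorem integral_shift (hA : IsLipschitzFamily A L) (u : C(ℝ≥0, X)) (s t θ : ℝ≥0) :
    ∫ τ in (0 : ℝ)..(s + t : ℝ≥0), A ((s + t + θ : ℝ≥0) - τ) (u τ.toNNReal) =
      (∫ τ in (0 : ℝ)..s, A ((s + t + θ : ℝ≥0) - τ) (u τ.toNNReal)) +
        ∫ τ in (0 : ℝ)..t, A ((t + θ : ℝ≥0) - τ) (shiftPath s u τ.toNNReal) := by
  rw [← intervalIntegral.integral_add_adjacent_intervals (hA.intervalIntegrable u _ 0 s)
    (hA.intervalIntegrable u _ s (s + t : ℝ≥0))]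
  congr 1
  have h := intervalIntegral.integral_comp_add_left (a := 0) (b := (t : ℝ))
    (fun τ => A ((s + t + θ : ℝ≥0) - τ) (u τ.toNNReal)) (s : ℝ)
  rw [add_zero, ← NNReal.coe_add] at h
  rw [← h]
  refine intervalIntegral.integral_congr fun τ hτ => ?_
  rw [uIcc_of_le t.coe_nonneg] at hτ
  simp only [shiftPath, ContinuousMap.coe_mk]
  rw [Real.toNNReal_add s.coe_nonneg hτ.1, Real.toNNReal_coe]
  congr 1
  push_cast
  ring

/-- The path `θ ↦ φ (t + θ) + ∫_0^t A (t + θ - τ) (u τ) dτ`. -/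
noncomputable def evolve (hA : IsLipschitzFamily A L) (t : ℝ≥0) (φ u : C(ℝ≥0, X)) :
    C(ℝ≥0, X) := shiftPath t φ + volterraTail hA u t

theorem evolve_apply (hA : IsLipschitzFamily A L) (t : ℝ≥0) (φ u : C(ℝ≥0, X)) (θ : ℝ≥0) :
    evolve hA t φ u θ = φ (t + θ) + ∫ τ in (0 : ℝ)..t, A ((t + θ : ℝ≥0) - τ) (u τ.toNNReal) := rfl

theorem IsVolterraSolution.shift (hA : IsLipschitzFamily A L) {φ u : C(ℝ≥0, X)}
    (hu : IsVolterraSolution A φ u) (s : ℝ≥0) :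
    IsVolterraSolution A (evolve hA s φ u) (shiftPath s u) := by
  intro t
  have h := integral_shift hA u s t 0
  simp only [add_zero] at h
  rw [evolve_apply, add_assoc, ← h]
  exact hu (s + t)

theorem evolve_add (hA : IsLipschitzFamily A L) (φ u : C(ℝ≥0, X)) (s t : ℝ≥0) :
    evolve hA (s + t) φ u = evolve hA t (evolve hA s φ u) (shiftPath s u) := by
  ext θ
  rw [evolve_apply, evolve_apply, evolve_apply, integral_shift hA, add_assoc s t θ, add_assoc]

theorem evolve_zero (hA : IsLipschitzFamily A L) (φ u : C(ℝ≥0, X)) : evolve hA 0 φ u = φ := by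
  ext θ
  rw [evolve_apply, zero_add, NNReal.coe_zero, intervalIntegral.integral_same, add_zero]

theorem norm_evolve_sub_le (hA : IsLipschitzFamily A L) {φ ψ u v : C(ℝ≥0, X)}
    (hu : IsVolterraSolution A φ u) (hv : IsVolterraSolution A ψ v) {C : ℝ} {t θ : ℝ≥0}
    (h : ∀ r ≤ t + θ, ‖φ r - ψ r‖ ≤ C) :
    ‖evolve hA t φ u θ - evolve hA t ψ v θ‖ ≤ (1 + Real.exp (2 * L * t)) * C := by
  have hC : 0 ≤ C := (norm_nonneg _).trans (h 0 zero_le)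
  rw [evolve_apply, evolve_apply, add_sub_add_comm, one_add_mul]
  refine (norm_add_le _ _).trans (add_le_add (h _ le_rfl)
    ((hA.norm_integral_sub_le u v _ t.coe_nonneg).trans ?_))
  -- The stability bound `2C e^{2Lτ}` on `[0, t]` integrates to `C e^{2Lt}`.
  have := mul_integral_le_of_le_exp hA.pos (((continuous_path u).sub (continuous_path v)).norm) t.coe_nonneg
    (show 0 ≤ 2 * C by positivity) (fun τ h0 hτ => by
      have h1 := hu.norm_sub_le hA hv (T := t) (fun r hr => h r (hr.trans le_self_add))
        (t := τ.toNNReal) (Real.toNNReal_le_iff_le_coe.2 hτ)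
      rwa [Real.coe_toNNReal τ h0] at h1)
  refine this.trans_eq ?_
  ring

end volterra

end RayleighStokes

namespace RayleighStokes

open Filter Topology

section metric

variable {𝕜 : Type} [RCLike 𝕜] {d : ℕ} {p : ℝ≥0∞} [Fact (1 ≤ p)]

/-! ### The metric of uniform convergence on compact sets -/

theorem norm_sub_le_supDist (n : ℕ) (φ h : PathSpace 𝕜 d p) {t : ℝ≥0} (ht : t ≤ n) :
    ‖φ t - h t‖ ≤ supDist n φ h :=
  le_csSup (isCompact_Icc.image (by fun_prop)).bddAbove ⟨t, ⟨zero_le, ht⟩, rfl⟩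

theorem supDist_le {n : ℕ} {φ h : PathSpace 𝕜 d p} {C : ℝ}
    (hC : ∀ t : ℝ≥0, t ≤ n → ‖φ t - h t‖ ≤ C) : supDist n φ h ≤ C := by
  refine csSup_le ((nonempty_Icc.2 zero_le).image _) ?_
  rintro _ ⟨t, ht, rfl⟩
  exact hC t ht.2

theorem supDist_nonneg (n : ℕ) (φ h : PathSpace 𝕜 d p) : 0 ≤ supDist n φ h :=
  (norm_nonneg _).trans (norm_sub_le_supDist n φ h zero_le)

theorem summable_rho (φ h : PathSpace 𝕜 d p) : Summable fun n : ℕ =>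
    (1 / 2 ^ (n + 1) : ℝ) * (supDist (n + 1) φ h / (1 + supDist (n + 1) φ h)) := by
  have hs : Summable fun n : ℕ => (1 / 2 : ℝ) ^ (n + 1) :=
    (summable_nat_add_iff 1).2 summable_geometric_two
  refine Summable.of_nonneg_of_le (fun n => ?_) (fun n => ?_) hs
  · have := supDist_nonneg (n + 1) φ h
    positivity
  · have h0 := supDist_nonneg (n + 1) φ h
    rw [one_div_pow]
    refine mul_le_of_le_one_right (by positivity) ?_
    rw [div_le_one (by positivity)]
    linarith

/-- The function `x / (1 + x)` is increasing and, for `C ≥ 1`, its value at `C x` is at most `C`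
times its value at `x`. Shifting the index by `N` changes the weights by `2^N`. -/
theorem rho_le_of_supDist_le {φ₁ ψ₁ φ ψ : PathSpace 𝕜 d p} {C : ℝ} (hC : 1 ≤ C) (N : ℕ)
    (h : ∀ n : ℕ, supDist (n + 1) φ₁ ψ₁ ≤ C * supDist (n + N + 1) φ ψ) :
    rho φ₁ ψ₁ ≤ C * 2 ^ N * rho φ ψ := by
  set g : ℕ → ℝ := fun n =>
    (1 / 2 ^ (n + 1)) * (supDist (n + 1) φ ψ / (1 + supDist (n + 1) φ ψ)) with hg
  have hsum : Summable g := summable_rho φ ψ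
  have hg0 : ∀ n, 0 ≤ g n := fun n => by
    have := supDist_nonneg (n + 1) φ ψ
    positivity
  have hterm : ∀ n : ℕ, (1 / 2 ^ (n + 1) : ℝ) * (supDist (n + 1) φ₁ ψ₁ /
      (1 + supDist (n + 1) φ₁ ψ₁)) ≤ C * 2 ^ N * g (n + N) := by
    intro n
    have h1 := supDist_nonneg (n + 1) φ₁ ψ₁
    have h2 := supDist_nonneg (n + N + 1) φ ψ
    have h3 : supDist (n + 1) φ₁ ψ₁ / (1 + supDist (n + 1) φ₁ ψ₁) ≤
        C * (supDist (n + N + 1) φ ψ / (1 + supDist (n + N + 1) φ ψ)) := by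
      rw [← mul_div_assoc, div_le_div_iff₀ (by positivity) (by positivity)]
      nlinarith [h n, mul_nonneg h1 h2, mul_nonneg (mul_nonneg h1 h2) (sub_nonneg.2 hC)]
    have h4 : C * 2 ^ N * g (n + N) = (1 / 2 ^ (n + 1)) *
        (C * (supDist (n + N + 1) φ ψ / (1 + supDist (n + N + 1) φ ψ))) := by
      simp only [hg, pow_add]
      field_simp
    rw [h4]
    exact mul_le_mul_of_nonneg_left h3 (by positivity)
  have hshift : Summable fun n => g (n + N) := (summable_nat_add_iff N).2 hsum
  calc rho φ₁ ψ₁ ≤ ∑' n, C * 2 ^ N * g (n + N) :=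
        (summable_rho φ₁ ψ₁).tsum_le_tsum hterm (hshift.mul_left _)
    _ = C * 2 ^ N * ∑' n, g (n + N) := tsum_mul_left
    _ ≤ C * 2 ^ N * rho φ ψ := by
        refine mul_le_mul_of_nonneg_left ?_ (by positivity)
        have := hsum.sum_add_tsum_nat_add N
        have h0 : 0 ≤ ∑ i ∈ Finset.range N, g i := Finset.sum_nonneg fun i _ => hg0 i
        change _ ≤ ∑' n, g n
        linarith

/-! ### The semilinear equation -/

variable {k : ℝ → ℝ} {f : LpSpace 𝕜 d p → LpSpace 𝕜 d p}

theorem isLipschitzFamily_solutionOperator (hp : p ≠ ∞) (hk : IsCompletelyMonotone k)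
    (hi : IsLocallyIntegrableKernel k) (hf₀ : f 0 = 0) {L : ℝ} (hL : 0 < L)
    (hf : ∀ u v, ‖f u - f v‖ ≤ L * ‖u - v‖) :
    IsLipschitzFamily (fun t x => solutionOperator k (max t 0) (f x)) L where
  pos := hL
  map_zero t := by rw [hf₀, solutionOperator_zero_right]
  lipschitz t u v :=
    (norm_solutionOperator_sub_le hp hk hi (le_max_right t 0) _ _).trans (hf u v)
  measurable x := stronglyMeasurable_solutionOperator hp hk hi (f x)

/-- On `[0, t]` with `t ≤ r` the truncation `max (r - τ) 0` is inactive. -/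
theorem duhamelIntegrand_eqOn (k : ℝ → ℝ) (f : LpSpace 𝕜 d p → LpSpace 𝕜 d p)
    (u : PathSpace 𝕜 d p) {t r : ℝ} (ht : 0 ≤ t) (htr : t ≤ r) :
    EqOn (duhamelIntegrand k f u r)
      (fun τ => solutionOperator k (max (r - τ) 0) (f (u τ.toNNReal))) (uIcc 0 t) := by
  intro τ hτ
  rw [uIcc_of_le ht] at hτ
  simp only [duhamelIntegrand]
  rw [max_eq_left (by linarith [hτ.2])]

theorem integral_duhamelIntegrand (k : ℝ → ℝ) (f : LpSpace 𝕜 d p → LpSpace 𝕜 d p)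
    (u : PathSpace 𝕜 d p) {t r : ℝ} (ht : 0 ≤ t) (htr : t ≤ r) :
    ∫ τ in (0 : ℝ)..t, duhamelIntegrand k f u r τ =
      ∫ τ in (0 : ℝ)..t, solutionOperator k (max (r - τ) 0) (f (u τ.toNNReal)) :=
  intervalIntegral.integral_congr (duhamelIntegrand_eqOn k f u ht htr)

theorem intervalIntegrable_duhamelIntegrand {L : ℝ}
    (hA : IsLipschitzFamily (fun t x => solutionOperator k (max t 0) (f x)) L)
    (u : PathSpace 𝕜 d p) {t r : ℝ} (ht : 0 ≤ t) (htr : t ≤ r) :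
    IntervalIntegrable (duhamelIntegrand k f u r) volume 0 t :=
  (hA.intervalIntegrable u r 0 t).congr
    ((duhamelIntegrand_eqOn k f u ht htr).symm.mono uIoc_subset_uIcc)

theorem isGeneralizedMildSolution_iff {L : ℝ}
    (hA : IsLipschitzFamily (fun t x => solutionOperator k (max t 0) (f x)) L)
    (φ u : PathSpace 𝕜 d p) :
    IsGeneralizedMildSolution k f φ u ↔
      IsVolterraSolution (fun t x => solutionOperator k (max t 0) (f x)) φ u := by
  refine forall_congr' fun t => ?_
  rw [integral_duhamelIntegrand k f u t.coe_nonneg le_rfl]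
  exact and_iff_right (intervalIntegrable_duhamelIntegrand hA u t.coe_nonneg le_rfl)

end metric

end RayleighStokes

theorem mainTheorem5 {𝕜 : Type} [RCLike 𝕜] (d : ℕ) (p : ℝ≥0∞) [Fact (1 ≤ p)] (hp : p ≠ ∞)
    (k : ℝ → ℝ) (hk : RayleighStokes.IsCompletelyMonotone k)
    (hk_int : RayleighStokes.IsLocallyIntegrableKernel k)
    (f : RayleighStokes.LpSpace 𝕜 d p → RayleighStokes.LpSpace 𝕜 d p)
    (hf : RayleighStokes.ConditionFf f) :
    (∀ φ : RayleighStokes.PathSpace 𝕜 d p,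
      ∃! u : RayleighStokes.PathSpace 𝕜 d p, RayleighStokes.IsGeneralizedMildSolution k f φ u) ∧
    ∃ T : ℝ≥0 → RayleighStokes.PathSpace 𝕜 d p → RayleighStokes.PathSpace 𝕜 d p,
      (∀ φ u : RayleighStokes.PathSpace 𝕜 d p, RayleighStokes.IsGeneralizedMildSolution k f φ u →
        ∀ t θ : ℝ≥0,
          IntervalIntegrable (RayleighStokes.duhamelIntegrand k f u (t + θ)) volume 0 t ∧
          T t φ θ =
            φ (t + θ) + ∫ τ in (0 : ℝ)..t, RayleighStokes.duhamelIntegrand k f u (t + θ) τ) ∧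
      T 0 = id ∧
      (∀ t s : ℝ≥0, T (t + s) = T t ∘ T s) ∧
      ∀ t : ℝ≥0, ∃ K : ℝ, 0 ≤ K ∧
        ∀ φ ψ : RayleighStokes.PathSpace 𝕜 d p,
          RayleighStokes.rho (T t φ) (T t ψ) ≤ K * RayleighStokes.rho φ ψ := by
  obtain ⟨hf₀, L, hL, hf⟩ := hf
  have hA := RayleighStokes.isLipschitzFamily_solutionOperator hp hk hk_int hf₀ hL hf
  have hiff := RayleighStokes.isGeneralizedMildSolution_iff hA
  choose U hU using RayleighStokes.exists_isVolterraSolution hA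
  refine ⟨fun φ => ⟨U φ, (hiff φ _).2 (hU φ), fun v hv =>
    ((hiff φ v).1 hv).unique hA (hU φ)⟩, fun t φ => RayleighStokes.evolve hA t φ (U φ),
    ?_, ?_, ?_, ?_⟩
  · intro φ u hu t θ
    have htr : (t : ℝ) ≤ (t + θ : ℝ) := le_add_of_nonneg_right θ.coe_nonneg
    refine ⟨RayleighStokes.intervalIntegrable_duhamelIntegrand hA u t.coe_nonneg htr, ?_⟩
    rw [RayleighStokes.integral_duhamelIntegrand k f u t.coe_nonneg htr,
      ((hiff φ u).1 hu).unique hA (hU φ)]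
    exact RayleighStokes.evolve_apply hA t φ (U φ) θ
  · exact funext fun φ => RayleighStokes.evolve_zero hA φ (U φ)
  · intro t s
    funext φ
    -- Uniqueness identifies the solution for `T_s φ` with the restarted solution for `φ`.
    have h := (hU (RayleighStokes.evolve hA s φ (U φ))).unique hA ((hU φ).shift hA s)
    simp only [Function.comp_apply]
    rw [h, add_comm t s, RayleighStokes.evolve_add]
  · intro t
    obtain ⟨N, hN⟩ := exists_nat_ge t
    -- For `θ ≤ n + 1` the value `T_t φ θ` depends on `φ` only over `[0, t + θ]`, inside `[0, n + N
    -- + 1]` since `t ≤ N`.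
    refine ⟨(1 + Real.exp (2 * L * t)) * 2 ^ N, by positivity, fun φ ψ => ?_⟩
    refine RayleighStokes.rho_le_of_supDist_le (by linarith [Real.exp_pos (2 * L * t)]) N
      fun n => RayleighStokes.supDist_le fun θ hθ => ?_
    refine RayleighStokes.norm_evolve_sub_le hA (hU φ) (hU ψ) fun r hr =>
      RayleighStokes.norm_sub_le_supDist _ φ ψ (hr.trans ?_)
    refine (add_le_add hN hθ).trans_eq ?_
    push_cast
    ring
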